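/- Let $0<r<1$, let $A_r=\{z\in\mathbb{C}: r<|z|<1\}$, let $H^\infty(A_r)$ be the algebra of bounded holomorphic functions on $A_r$, and let $\|\phi\|_\infty=\sup_{z\in A_r}|\phi(z)|$. Let $H^2_2$ be the Drury--Arveson space on the open unit ball $\mathbb{B}_2\subset\mathbb{C}^2$, i.e. the reproducing kernel Hilbert space with kernel $a_2(\lambda,\mu)=\frac{1}{1-\langle\lambda,\mu\rangle}$. Let $\mathrm{Mult}(H^2_2)$ be the set of functions $\psi:\mathbb{B}_2\to\mathbb{C}$ for which $M_\psi f=\psi f$ defines a bounded operator on $H^2_2$, with $\|\psi\|_{\mathrm{Mult}(H^2_2)}=\|M_\psi\|$. Then for every $\phi\in H^\infty(A_r)$ the minimum $$\min\Big\{\|\psi\|_{\mathrm{Mult}(H^2_2)}:\ \psi\in\mathrm{Mult}(H^2_2)\ \text{and}\ \psi\Big(\frac{z}{\sqrt{r^2+1}},\frac{r}{\sqrt{r^2+1}}\frac1z\Big)=\phi(z)\ \text{for all } z\in A_r\Big\}$$ exists (in particular, such $\psi$ exist) and lies in the interval $[\|\phi\|_\infty,\sqrt2\,\|\phi\|_\infty]$.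 Moreover, for every fixed $r\in(0,1)$ the constant $\sqrt2$ is the best possible: if $C\in\mathbb{R}$ is such that this minimum is at most $C\|\phi\|_\infty$ for all $\phi\in H^\infty(A_r)$, then $C\ge\sqrt2$. -/

import Mathlib

noncomputable section

open scoped ComplexOrder

/-! ### The Drury-Arveson space -/

/-- The open unit ball `𝔹_d` of `ℂ^d` (Euclidean norm). -/
abbrev UnitBall (d : ℕ) : Type := Metric.ball (0 : EuclideanSpace ℂ (Fin d)) 1

/-- The Drury-Arveson kernel `a_d(x, y) = 1 / (1 - ⟨x, y⟩)` on `𝔹_d`, where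
`⟨x, y⟩ = ∑ x_i * conj (y_i)`; Mathlib's inner product is conjugate-linear in its first
argument, so that this is `inner ℂ y x`. -/
def druryArvesonKernel (d : ℕ) (x y : UnitBall d) : ℂ :=
  1 / (1 - inner ℂ (y : EuclideanSpace ℂ (Fin d)) (x : EuclideanSpace ℂ (Fin d)))

/-- The Drury-Arveson kernel as an operator-valued (here: scalar) matrix, the form in which
`RKHS.OfKernel` takes a kernel. -/
def druryArvesonMatrix (d : ℕ) : Matrix (UnitBall d) (UnitBall d) (ℂ →L[ℂ] ℂ) :=
  Matrix.of fun x y => druryArvesonKernel d x y • ContinuousLinearMap.id ℂ ℂ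

theorem posSemidef_of_inner {X E : Type*} [NormedAddCommGroup E] [InnerProductSpace ℂ E]
    (v : X → E) : (Matrix.of fun x y : X => (inner ℂ (v y) (v x) : ℂ)).PosSemidef := by
  refine ⟨?_, fun w => ?_⟩
  · ext x y
    simp
  · have h : (w.sum fun x a => w.sum fun y b => star a * (inner ℂ (v y) (v x) : ℂ) * b) =
        inner ℂ (w.sum fun y b => star b • v y) (w.sum fun x a => star a • v x) := by
      simp only [Finsupp.sum, sum_inner, inner_sum, inner_smul_left, inner_smul_right,
        Finset.mul_sum]
      refine Finset.sum_congr rfl fun x _ => Finset.sum_congr rfl fun y _ => ?_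
      simp
      ring
    simp only [Matrix.of_apply]
    rw [h]
    rw [inner_self_eq_norm_sq_to_K]
    exact pow_nonneg (by simp) 2

theorem posSemidef_inner_pow (d n : ℕ) :
    (Matrix.of fun x y : UnitBall d =>
      (inner ℂ (y : EuclideanSpace ℂ (Fin d)) (x : EuclideanSpace ℂ (Fin d))) ^ n).PosSemidef := by
  have hgram := posSemidef_of_inner (fun x : UnitBall d => (x : EuclideanSpace ℂ (Fin d)))
  induction n with
  | zero =>
    have h := posSemidef_of_inner (fun _ : UnitBall d => (1 : ℂ))
    simpa using h
  | succ n ih =>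
    have h := Matrix.PosSemidef.hadamard (𝕜 := ℂ) ih hgram
    have e : (Matrix.of fun x y : UnitBall d =>
        (inner ℂ (y : EuclideanSpace ℂ (Fin d)) (x : EuclideanSpace ℂ (Fin d))) ^ (n + 1)) =
        Matrix.hadamard (Matrix.of fun x y : UnitBall d =>
        (inner ℂ (y : EuclideanSpace ℂ (Fin d)) (x : EuclideanSpace ℂ (Fin d))) ^ n)
        (Matrix.of fun x y : UnitBall d =>
        (inner ℂ (y : EuclideanSpace ℂ (Fin d)) (x : EuclideanSpace ℂ (Fin d)))) := by
      ext x y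
      simp [pow_succ]
    rw [e]
    exact h

theorem norm_inner_unitBall_lt_one (d : ℕ) (x y : UnitBall d) :
    ‖inner ℂ (y : EuclideanSpace ℂ (Fin d)) (x : EuclideanSpace ℂ (Fin d))‖ < 1 := by
  have hx : ‖(x : EuclideanSpace ℂ (Fin d))‖ < 1 := mem_ball_zero_iff.mp x.2
  have hy : ‖(y : EuclideanSpace ℂ (Fin d))‖ < 1 := mem_ball_zero_iff.mp y.2
  refine (norm_inner_le_norm _ _).trans_lt ?_
  nlinarith [norm_nonneg (x : EuclideanSpace ℂ (Fin d)),
    norm_nonneg (y : EuclideanSpace ℂ (Fin d))]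

theorem hasSum_druryArvesonKernel (d : ℕ) (x y : UnitBall d) :
    HasSum (fun n : ℕ =>
      (inner ℂ (y : EuclideanSpace ℂ (Fin d)) (x : EuclideanSpace ℂ (Fin d))) ^ n)
      (druryArvesonKernel d x y) := by
  have h := hasSum_geometric_of_norm_lt_one (norm_inner_unitBall_lt_one d x y)
  simpa [druryArvesonKernel] using h

theorem druryArvesonKernel_conj (d : ℕ) (x y : UnitBall d) :
    star (druryArvesonKernel d x y) = druryArvesonKernel d y x := by
  simp [druryArvesonKernel]

theorem posSemidef_druryArvesonMatrix (d : ℕ) : (druryArvesonMatrix d).PosSemidef := by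
  have tf := (RKHS.posSemidef_tfae (K := druryArvesonMatrix d)).out 0 2
  refine tf.mpr ⟨?_, fun w => ?_⟩
  · ext x y
    have h := druryArvesonKernel_conj d y x
    have e : ContinuousLinearMap.adjoint (ContinuousLinearMap.id ℂ ℂ) =
        ContinuousLinearMap.id ℂ ℂ := ContinuousLinearMap.adjoint_id
    simpa [druryArvesonMatrix, ContinuousLinearMap.star_eq_adjoint, e] using h
  · have key : HasSum (fun n : ℕ => (w.sum fun x a => w.sum fun y b =>
        star a * (inner ℂ (y : EuclideanSpace ℂ (Fin d)) (x : EuclideanSpace ℂ (Fin d))) ^ n * b))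
        (w.sum fun x a => w.sum fun y b => star a * druryArvesonKernel d x y * b) := by
      simp only [Finsupp.sum]
      exact hasSum_sum fun x _ => hasSum_sum fun y _ =>
        ((hasSum_druryArvesonKernel d x y).mul_left _).mul_right _
    have hnn := key.nonneg (fun n => (posSemidef_inner_pow d n).2 w)
    have hre := (RCLike.le_iff_re_im.mp hnn).1
    convert hre using 2
    simp
    simp only [Finsupp.sum]
    refine Finset.sum_congr rfl fun x _ => Finset.sum_congr rfl fun y _ => ?_
    rw [← druryArvesonKernel_conj d y x]
    simp [druryArvesonMatrix]
    ring

instance factPosSemidefDruryArvesonMatrix (d : ℕ) :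
    Fact (druryArvesonMatrix d).PosSemidef :=
  ⟨posSemidef_druryArvesonMatrix d⟩

/-- The Drury-Arveson space `H²_d`: the reproducing kernel Hilbert space of functions on `𝔹_d`
with kernel `a_d`. -/
abbrev DruryArveson (d : ℕ) : Type := RKHS.OfKernel (druryArvesonMatrix d)

/-! ### Multipliers -/

/-- `ψ : X → ℂ` is a multiplier of the reproducing kernel Hilbert space `H` on `X`:
`f ↦ ψ f` defines a bounded operator `H → H`. -/
def IsMultiplier (H : Type*) {X : Type*} [NormedAddCommGroup H] [InnerProductSpace ℂ H]
    [RKHS ℂ H X ℂ] (ψ : X → ℂ) : Prop :=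
  ∃ M : H →L[ℂ] H, ∀ (f : H) (x : X), M f x = ψ x * f x

open scoped Classical in
/-- The multiplier norm `‖ψ‖_{Mult(H)}`: the operator norm of `M_ψ : f ↦ ψ f`
(and `0` if `ψ` is not a multiplier). -/
def multiplierNorm (H : Type*) {X : Type*} [NormedAddCommGroup H] [InnerProductSpace ℂ H]
    [RKHS ℂ H X ℂ] (ψ : X → ℂ) : ℝ :=
  if h : IsMultiplier H ψ then ‖h.choose‖ else 0

theorem multiplierNorm_eq {H X : Type*} [NormedAddCommGroup H] [InnerProductSpace ℂ H]
    [RKHS ℂ H X ℂ] {ψ : X → ℂ} (M : H →L[ℂ] H) (hM : ∀ (f : H) (x : X), M f x = ψ x * f x) :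
    multiplierNorm H ψ = ‖M‖ := by
  have h : IsMultiplier H ψ := ⟨M, hM⟩
  have e : h.choose = M := by
    ext1 f
    exact RKHS.ext fun x => (h.choose_spec f x).trans (hM f x).symm
  rw [multiplierNorm, dif_pos h, e]

/-! ### The annulus -/

/-- The annulus `A_r = {z : r < |z| < 1}`. -/
def annulus (r : ℝ) : Set ℂ := {z | r < ‖z‖ ∧ ‖z‖ < 1}

/-- `φ ∈ H^∞(A_r)`: `φ` is holomorphic and bounded on `A_r`. -/
def IsHInf (r : ℝ) (φ : ℂ → ℂ) : Prop :=
  DifferentiableOn ℂ φ (annulus r) ∧ ∃ C : ℝ, ∀ z ∈ annulus r, ‖φ z‖ ≤ C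

/-- The supremum norm `‖φ‖_∞` over `A_r`. -/
def supNorm (r : ℝ) (φ : ℂ → ℂ) : ℝ := ⨆ z : annulus r, ‖φ z‖

theorem annulusPoint_mem (r : ℝ) (hr : 0 < r) (z : annulus r) :
    !₂[(z : ℂ) / (√(r ^ 2 + 1) : ℂ), (r : ℂ) / (√(r ^ 2 + 1) : ℂ) * (1 / (z : ℂ))] ∈
      Metric.ball (0 : EuclideanSpace ℂ (Fin 2)) 1 := by
  obtain ⟨z, h1, h2⟩ := z
  have hz : 0 < ‖z‖ := hr.trans h1
  have hs : √(r ^ 2 + 1) ^ 2 = r ^ 2 + 1 := Real.sq_sqrt (by positivity)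
  rw [mem_ball_zero_iff, EuclideanSpace.norm_eq, Real.sqrt_lt' one_pos]
  simp only [Fin.sum_univ_two, Matrix.cons_val_zero, Matrix.cons_val_one, norm_mul, norm_div,
    Complex.norm_real, Real.norm_eq_abs, norm_one, mul_pow, div_pow, sq_abs, hs, one_pow]
  have e : ‖z‖ ^ 2 / (r ^ 2 + 1) + r ^ 2 / (r ^ 2 + 1) * (1 / ‖z‖ ^ 2) =
      (‖z‖ ^ 4 + r ^ 2) / ((r ^ 2 + 1) * ‖z‖ ^ 2) := by
    field_simp
  rw [e, div_lt_one (by positivity)]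
  have h3 : r ^ 2 < ‖z‖ ^ 2 := by gcongr
  have h4 : ‖z‖ ^ 2 < 1 := by nlinarith
  nlinarith [mul_pos (sub_pos.mpr h3) (sub_pos.mpr h4)]

/-- The embedding `z ↦ (z / √(r²+1), (r / √(r²+1)) * (1/z))` of `A_r` into `𝔹_2`. -/
def annulusToBall (r : ℝ) (hr : 0 < r) (z : annulus r) : UnitBall 2 :=
  ⟨!₂[(z : ℂ) / (√(r ^ 2 + 1) : ℂ), (r : ℂ) / (√(r ^ 2 + 1) : ℂ) * (1 / (z : ℂ))],
    annulusPoint_mem r hr z⟩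

/-- The set of the multiplier norms of all `ψ ∈ Mult(H²_2)` that extend `φ`, that is,
`ψ(z / √(r²+1), (r / √(r²+1)) * (1/z)) = φ(z)` for all `z ∈ A_r`. -/
def extensionNorms (r : ℝ) (hr : 0 < r) (φ : ℂ → ℂ) : Set ℝ :=
  {c | ∃ ψ : UnitBall 2 → ℂ, IsMultiplier (DruryArveson 2) ψ ∧
    (∀ z : annulus r, ψ (annulusToBall r hr z) = φ z) ∧
    multiplierNorm (DruryArveson 2) ψ = c}

end

noncomputable section

open scoped ComplexOrder

universe u

/-! Everything is reduced to positivity of the Pick kernel `(m² - φ(z) φ(w)*) a₂(z, w)` on the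
embedded annulus. Restricting a multiplier of norm `m` makes this kernel positive semidefinite.
Conversely, by the Pick property (`exists_extension_of_posSemidef`, a lurking isometry argument),
positivity for `m` yields an extension of norm at most `m`. The admissible `m` form a closed set, so
a least one exists, and it is the minimal extension norm. The diagonal of the kernel gives the lower
bound `‖φ‖_∞`.

For the upper bound, partial fractions turn the restricted kernel, up to a positive constant, into
`K = ∑ (z w*)ⁿ / max(1, rⁿ)²` (`hasSum_maxWeight`). The Hardy kernel `k = ∑ (z w*)ⁿ / (1 + r²ⁿ)`
belongs to the norm that adds the `L²` norms on the two boundary circles, so `φ` multiplies with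
norm at most `M = ‖φ‖_∞` there and `(M² - φφ*) k` is positive (`norm_sum_smul_laurentVec_le`). Since
`max(1, x)² ≤ 1 + x² ≤ 2 max(1, x)²`, both `K - k` and `2k - K` are positive, and `(2M² - φφ*) K =
2M² (K - k) + 2 (M² - φφ*) k + φφ* (2k - K)`.

For sharpness take `φ = z^N + r^N z^(-N)`. Its supremum norm is at most `1 + r^N`, but in the space
with kernel `K` the constant `1` has norm `1`, while `φ · 1` is a sum of two orthogonal unit vectors
and has norm `√2` (`sqrt_two_le_of_posSemidef`). Let `N → ∞`. -/

theorem Matrix.PosSemidef.congr {X : Type*} {A B : Matrix X X ℂ} (hA : A.PosSemidef)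
    (h : ∀ x y, A x y = B x y) : B.PosSemidef :=
  (Matrix.ext h : A = B) ▸ hA

/-! ### Gram matrices and norm-bounded maps between vector families. -/

section Gram

variable {X E F : Type*} [NormedAddCommGroup E] [InnerProductSpace ℂ E]
  [NormedAddCommGroup F] [InnerProductSpace ℂ F]

theorem sum_star_mul_inner_mul (v : X → E) (w : X →₀ ℂ) :
    (w.sum fun x a => w.sum fun y b => star a * (inner ℂ (v y) (v x) : ℂ) * b) =
      ((‖w.sum fun x a => star a • v x‖ ^ 2 : ℝ) : ℂ) := by
  have h : (w.sum fun x a => w.sum fun y b => star a * (inner ℂ (v y) (v x) : ℂ) * b) =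
      inner ℂ (w.sum fun y b => star b • v y) (w.sum fun x a => star a • v x) := by
    simp only [Finsupp.sum, sum_inner, inner_sum, inner_smul_left, inner_smul_right,
      Finset.mul_sum]
    refine Finset.sum_congr rfl fun x _ => Finset.sum_congr rfl fun y _ => ?_
    simp
    ring
  rw [h, inner_self_eq_norm_sq_to_K]
  simp

theorem posSemidef_gram_sub_iff {c : ℝ} (hc : 0 ≤ c) (p : X → E) (q : X → F) :
    (Matrix.of fun x y : X =>
      (c : ℂ) ^ 2 * (inner ℂ (p y) (p x) : ℂ) - (inner ℂ (q y) (q x) : ℂ)).PosSemidef ↔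
    ∀ w : X →₀ ℂ, ‖w.sum fun x a => a • q x‖ ≤ c * ‖w.sum fun x a => a • p x‖ := by
  have key : ∀ w : X →₀ ℂ, (w.sum fun x a => w.sum fun y b => star a *
      ((c : ℂ) ^ 2 * (inner ℂ (p y) (p x) : ℂ) - (inner ℂ (q y) (q x) : ℂ)) * b) =
      (((c * ‖w.sum fun x a => star a • p x‖) ^ 2 - ‖w.sum fun x a => star a • q x‖ ^ 2 : ℝ) : ℂ) := by
    intro w
    rw [mul_pow, Complex.ofReal_sub, Complex.ofReal_mul, ← sum_star_mul_inner_mul,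
      ← sum_star_mul_inner_mul]
    simp only [Finsupp.sum, Finset.mul_sum, ← Finset.sum_sub_distrib]
    refine Finset.sum_congr rfl fun x _ => Finset.sum_congr rfl fun y _ => ?_
    push_cast
    ring
  constructor
  · intro h w
    -- The quadratic form produces combinations with conjugated coefficients, so it is tested on the
    -- conjugate of `w`.
    have h2 := h.2 (w.mapRange star (star_zero _))
    simp only [Matrix.of_apply] at h2
    rw [key, ← Complex.ofReal_zero, Complex.real_le_real, sub_nonneg] at h2
    rw [Finsupp.sum_mapRange_index (by simp), Finsupp.sum_mapRange_index (by simp)] at h2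
    simp only [star_star] at h2
    exact (sq_le_sq₀ (norm_nonneg _) (by positivity)).mp h2
  · intro h
    refine ⟨?_, fun w => ?_⟩
    · ext x y
      simp
    · simp only [Matrix.of_apply]
      rw [key, ← Complex.ofReal_zero, Complex.real_le_real, sub_nonneg,
        sq_le_sq₀ (norm_nonneg _) (by positivity)]
      have h2 := h (w.mapRange star (star_zero _))
      rwa [Finsupp.sum_mapRange_index (by simp), Finsupp.sum_mapRange_index (by simp)] at h2

/-- The bound makes `∑ a • p x ↦ ∑ a • q x` well defined and continuous on the span of the `p x`. It
extends to the closed span by continuity, and to `E` by composing with the orthogonal projection. -/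
theorem exists_clm_of_norm_sum_le [CompleteSpace E] [CompleteSpace F] {c : ℝ} (hc : 0 ≤ c)
    {p : X → E} {q : X → F}
    (h : ∀ w : X →₀ ℂ, ‖w.sum fun x a => a • q x‖ ≤ c * ‖w.sum fun x a => a • p x‖) :
    ∃ V : E →L[ℂ] F, ‖V‖ ≤ c ∧ ∀ x, V (p x) = q x := by
  let P := Finsupp.linearCombination ℂ p
  let Q := Finsupp.linearCombination ℂ q
  let S : Submodule ℂ E := (LinearMap.range P).topologicalClosure
  have hS : ∀ w, P w ∈ S := fun w => subset_closure ⟨w, rfl⟩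
  let e : (X →₀ ℂ) →ₗ[ℂ] S := P.codRestrict S hS
  have hd : DenseRange e := by
    intro y
    rw [Topology.IsInducing.subtypeVal.closure_eq_preimage_closure_image]
    have : ((↑) '' Set.range e : Set E) = LinearMap.range P := by
      rw [← Set.range_comp]
      rfl
    have hy : (y : E) ∈ closure ((LinearMap.range P : Submodule ℂ E) : Set E) := y.2
    rw [← this] at hy
    exact hy
  have hn : ∀ w, ‖Q w‖ ≤ c * ‖e w‖ := fun w => h w
  have : CompleteSpace S := (Submodule.isClosed_topologicalClosure _).completeSpace_coe
  refine ⟨(Q.extendOfNorm e).comp S.orthogonalProjectionOnto, ?_, fun x => ?_⟩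
  · refine (ContinuousLinearMap.opNorm_comp_le _ _).trans ?_
    calc _ ≤ c * 1 := mul_le_mul (LinearMap.opNorm_extendOfNorm_le hd hc hn)
          (Submodule.orthogonalProjectionOnto_norm_le S) (by positivity) hc
      _ = c := mul_one c
  · have hp : P (Finsupp.single x 1) = p x := by simp [P]
    have hq : Q (Finsupp.single x 1) = q x := by simp [Q]
    have he : S.orthogonalProjectionOnto (p x) = e (Finsupp.single x 1) := by
      have : p x = ((e (Finsupp.single x 1) : S) : E) := hp.symm
      rw [this, Submodule.orthogonalProjectionOnto_mem_subspace_eq_self]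
    rw [ContinuousLinearMap.comp_apply, he, LinearMap.extendOfNorm_eq hd ⟨c, hn⟩, hq]

theorem norm_sum_le_of_clm {c : ℝ} {p : X → E} {q : X → F} (V : E →L[ℂ] F) (hV : ‖V‖ ≤ c)
    (h : ∀ x, V (p x) = q x) (w : X →₀ ℂ) :
    ‖w.sum fun x a => a • q x‖ ≤ c * ‖w.sum fun x a => a • p x‖ := by
  have : (w.sum fun x a => a • q x) = V (w.sum fun x a => a • p x) := by
    simp [Finsupp.sum, map_sum, h]
  rw [this]
  exact (V.le_opNorm _).trans (by gcongr)

end Gram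

/-! ### Positive kernels and multipliers of the Drury-Arveson space. -/

theorem posSemidef_smul_id {X : Type*} {K : Matrix X X ℂ} (hK : K.PosSemidef) :
    (Matrix.of fun x y => K x y • ContinuousLinearMap.id ℂ ℂ :
      Matrix X X (ℂ →L[ℂ] ℂ)).PosSemidef := by
  have tf := (RKHS.posSemidef_tfae (K := (Matrix.of fun x y =>
    K x y • ContinuousLinearMap.id ℂ ℂ : Matrix X X (ℂ →L[ℂ] ℂ)))).out 0 2
  refine tf.mpr ⟨?_, fun w => ?_⟩
  · ext x y
    have e : ContinuousLinearMap.adjoint (ContinuousLinearMap.id ℂ ℂ) =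
        ContinuousLinearMap.id ℂ ℂ := ContinuousLinearMap.adjoint_id
    have h := hK.1.apply x y
    simpa [ContinuousLinearMap.star_eq_adjoint, e] using h
  · have hre := (RCLike.le_iff_re_im.mp (hK.2 w)).1
    convert hre using 2
    simp
    simp only [Finsupp.sum]
    refine Finset.sum_congr rfl fun x _ => Finset.sum_congr rfl fun y _ => ?_
    have h := hK.1.apply x y
    rw [← h]
    simp
    ring

/-- The vectors are the kernel functions of the RKHS of the transposed kernel. The transpose is
needed because kernel functions at `y` and `x` have inner product equal to the kernel at `(y, x)`.
-/
theorem exists_gram_of_posSemidef {X : Type u} {K : Matrix X X ℂ} (hK : K.PosSemidef) :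
    ∃ (E : Type u) (_ : NormedAddCommGroup E) (_ : InnerProductSpace ℂ E) (_ : CompleteSpace E)
      (v : X → E), ∀ x y, K x y = inner ℂ (v y) (v x) := by
  let A : Matrix X X (ℂ →L[ℂ] ℂ) :=
    Matrix.of fun x y => K.transpose x y • ContinuousLinearMap.id ℂ ℂ
  have : Fact A.PosSemidef := ⟨posSemidef_smul_id hK.transpose⟩
  refine ⟨RKHS.OfKernel A, inferInstance, inferInstance, inferInstance,
    fun x => RKHS.kerFun (RKHS.OfKernel A) x 1, fun x y => ?_⟩
  rw [RKHS.kerFun_inner, RKHS.kerFun_apply, RKHS.OfKernel.kernel_ofKernel]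
  simp [A]

theorem inner_kerFun_druryArveson (d : ℕ) (x y : UnitBall d) :
    (inner ℂ (RKHS.kerFun (DruryArveson d) x (1 : ℂ)) (RKHS.kerFun (DruryArveson d) y (1 : ℂ)) : ℂ) =
      druryArvesonKernel d x y := by
  rw [RKHS.kerFun_inner, RKHS.kerFun_apply, RKHS.OfKernel.kernel_ofKernel]
  simp [druryArvesonMatrix]

theorem posSemidef_druryArvesonKernel (d : ℕ) :
    (Matrix.of fun x y : UnitBall d => druryArvesonKernel d x y).PosSemidef := by
  have h := (posSemidef_of_inner fun x : UnitBall d =>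
    RKHS.kerFun (DruryArveson d) x (1 : ℂ)).transpose
  exact h.congr fun x y => inner_kerFun_druryArveson d x y

theorem adjoint_kerFun_of_mul {d : ℕ} {ψ : UnitBall d → ℂ}
    (M : DruryArveson d →L[ℂ] DruryArveson d) (hM : ∀ f x, M f x = ψ x * f x) (x : UnitBall d) :
    ContinuousLinearMap.adjoint M (RKHS.kerFun (DruryArveson d) x (1 : ℂ)) =
      star (ψ x) • RKHS.kerFun (DruryArveson d) x (1 : ℂ) := by
  refine ext_inner_right ℂ fun f => ?_
  rw [ContinuousLinearMap.adjoint_inner_left, inner_smul_left, RKHS.kerFun_inner,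
    RKHS.kerFun_inner, hM]
  simp

/-- Kernel functions are eigenvectors of the adjoint of `M`, with eigenvalues `star (ψ x)`; the
claim is the bound `c` for this adjoint on their span, written as a Gram matrix. -/
theorem posSemidef_of_multiplier {d : ℕ} {ψ : UnitBall d → ℂ} {c : ℝ}
    (M : DruryArveson d →L[ℂ] DruryArveson d) (hM : ∀ f x, M f x = ψ x * f x) (hc : ‖M‖ ≤ c) :
    (Matrix.of fun x y : UnitBall d =>
      ((c : ℂ) ^ 2 - ψ x * star (ψ y)) * druryArvesonKernel d x y).PosSemidef := by
  have h := (posSemidef_gram_sub_iff ((norm_nonneg _).trans hc) _ _).mpr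
    (norm_sum_le_of_clm (ContinuousLinearMap.adjoint M) (c := c)
      (by rwa [LinearIsometryEquiv.norm_map]) (adjoint_kerFun_of_mul M hM))
  refine h.transpose.congr fun x y => ?_
  simp only [Matrix.of_apply, Matrix.transpose_apply, inner_smul_left, inner_smul_right,
    inner_kerFun_druryArveson]
  simp
  ring

/-- Positivity gives an operator scaling each kernel function by `star (ψ x)`; its adjoint is
multiplication by `ψ`, by the reproducing property. -/
theorem exists_multiplier_of_posSemidef {d : ℕ} {ψ : UnitBall d → ℂ} {c : ℝ} (hc : 0 ≤ c)
    (h : (Matrix.of fun x y : UnitBall d =>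
      ((c : ℂ) ^ 2 - ψ x * star (ψ y)) * druryArvesonKernel d x y).PosSemidef) :
    ∃ M : DruryArveson d →L[ℂ] DruryArveson d, ‖M‖ ≤ c ∧ ∀ f x, M f x = ψ x * f x := by
  have h2 := h.transpose
  obtain ⟨T, hT, hTk⟩ := exists_clm_of_norm_sum_le hc ((posSemidef_gram_sub_iff hc
    (fun x : UnitBall d => RKHS.kerFun (DruryArveson d) x (1 : ℂ))
    (fun x : UnitBall d => star (ψ x) • RKHS.kerFun (DruryArveson d) x (1 : ℂ))).mp (by
      refine h2.congr fun x y => ?_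
      simp only [Matrix.of_apply, Matrix.transpose_apply, inner_smul_left, inner_smul_right,
        inner_kerFun_druryArveson]
      simp
      ring))
  refine ⟨ContinuousLinearMap.adjoint T, by rwa [LinearIsometryEquiv.norm_map], fun f x => ?_⟩
  have e : ∀ g : DruryArveson d, g x = inner ℂ (RKHS.kerFun (DruryArveson d) x (1 : ℂ)) g := by
    intro g
    rw [RKHS.kerFun_inner]
    simp
  rw [e, ContinuousLinearMap.adjoint_inner_right, hTk, inner_smul_left, ← e]
  simp

/-! ### The Pick property through a lurking isometry. -/

section Pick

variable {d : ℕ} {E : Type*} [NormedAddCommGroup E] [InnerProductSpace ℂ E]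

/-- The row operator `u ↦ (x₁ u, …, x_d u)`. -/
def rowSMul (x : EuclideanSpace ℂ (Fin d)) (u : E) : PiLp 2 fun _ : Fin d => E :=
  WithLp.toLp 2 fun i => x i • u

theorem inner_rowSMul (x y : EuclideanSpace ℂ (Fin d)) (u v : E) :
    (inner ℂ (rowSMul y v) (rowSMul x u) : ℂ) = inner ℂ y x * inner ℂ v u := by
  simp only [rowSMul, PiLp.inner_apply, inner_smul_left, inner_smul_right, Finset.sum_mul]
  refine Finset.sum_congr rfl fun i _ => ?_
  simp
  ring

theorem norm_rowSMul (x : EuclideanSpace ℂ (Fin d)) (u : E) : ‖rowSMul x u‖ = ‖x‖ * ‖u‖ := by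
  have h := inner_rowSMul x x u u
  rw [inner_self_eq_norm_sq_to_K, inner_self_eq_norm_sq_to_K, inner_self_eq_norm_sq_to_K,
    ← mul_pow] at h
  have h2 : ‖rowSMul x u‖ ^ 2 = (‖x‖ * ‖u‖) ^ 2 := by exact_mod_cast h
  exact (sq_eq_sq₀ (norm_nonneg _) (by positivity)).mp h2

/-- `rowSMul x` as a continuous linear map. -/
def rowSMulCLM (x : EuclideanSpace ℂ (Fin d)) : E →L[ℂ] PiLp 2 fun _ : Fin d => E :=
  LinearMap.mkContinuous
    { toFun := rowSMul x
      map_add' := fun u v => by ext i; simp [rowSMul]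
      map_smul' := fun a u => by ext i; simp [rowSMul, smul_smul, mul_comm] } ‖x‖
    fun u => (norm_rowSMul x u).le

theorem existsUnique_eq_add_apply [CompleteSpace E] (T : E →L[ℂ] E) (hT : ‖T‖ < 1) (c : E) :
    ∃! g : E, g = c + T g := by
  have hu : ((Units.oneSub T hT : (E →L[ℂ] E)ˣ) : E →L[ℂ] E) = 1 - T := rfl
  set U := Units.oneSub T hT
  have iff : ∀ g : E, g = c + T g ↔ (U : E →L[ℂ] E) g = c := by
    intro g
    rw [hu]
    simp [sub_eq_iff_eq_add]
  refine ⟨(↑U⁻¹ : E →L[ℂ] E) c, ?_, fun g hg => ?_⟩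
  · refine (iff _).mpr ?_
    rw [← mul_apply_eq_comp, Units.mul_inv]
    simp
  · have := (iff g).mp hg
    rw [← this, ← mul_apply_eq_comp, Units.inv_mul]
    simp

/-- The scalar Pick property of the Drury-Arveson space: a function on a subset of the ball with
positive semidefinite Pick kernel extends to a multiplier. -/
theorem exists_extension_of_posSemidef {X : Type*} (l : X → UnitBall d) (φ : X → ℂ) {m : ℝ}
    (h : (Matrix.of fun x y : X =>
      ((m : ℂ) ^ 2 - φ x * star (φ y)) * druryArvesonKernel d (l x) (l y)).PosSemidef) :
    ∃ ψ : UnitBall d → ℂ, (∀ x, ψ (l x) = φ x) ∧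
      (Matrix.of fun x y : UnitBall d =>
        ((m : ℂ) ^ 2 - ψ x * star (ψ y)) * druryArvesonKernel d x y).PosSemidef := by
  have hm : ((|m| : ℝ) : ℂ) ^ 2 = (m : ℂ) ^ 2 := by
    rw [← Complex.ofReal_pow, ← Complex.ofReal_pow, sq_abs]
  have hne : ∀ x y : UnitBall d, 1 - (inner ℂ (y : EuclideanSpace ℂ (Fin d))
      (x : EuclideanSpace ℂ (Fin d)) : ℂ) ≠ 0 := by
    intro x y h0
    have := norm_inner_unitBall_lt_one d x y
    rw [← sub_eq_zero.mp h0] at this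
    simp at this
  -- Write the Pick kernel as `⟨g x, g y⟩` and clear the denominator: `m² + ⟨l x, l y⟩⟨g x, g y⟩ = φ
  -- x φ(y)* + ⟨g x, g y⟩`. The families `p` and `q` thus have equal Gram matrices, and a
  -- contraction `V` maps `p` to `q`.
  obtain ⟨E, _, _, _, g, hg⟩ := exists_gram_of_posSemidef h
  let p : X → WithLp 2 (ℂ × PiLp 2 fun _ : Fin d => E) :=
    fun x => WithLp.toLp 2 ((m : ℂ), rowSMul (l x : EuclideanSpace ℂ (Fin d)) (g x))
  let q : X → WithLp 2 (ℂ × E) := fun x => WithLp.toLp 2 (φ x, g x)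
  obtain ⟨V, hV, hVp⟩ := exists_clm_of_norm_sum_le zero_le_one
    ((posSemidef_gram_sub_iff zero_le_one p q).mp (by
      refine Matrix.PosSemidef.zero.congr fun x y => ?_
      simp only [Matrix.of_apply, Matrix.zero_apply, p, q, WithLp.prod_inner_apply, inner_rowSMul]
      have := hg x y
      simp only [Matrix.of_apply, druryArvesonKernel] at this
      rw [← this]
      have := hne (l x) (l y)
      field_simp
      simp [hm]
      ring))
  let D : (PiLp 2 fun _ : Fin d => E) →L[ℂ] E := LinearMap.mkContinuous
    { toFun := fun u => (V (WithLp.toLp 2 (0, u))).snd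
      map_add' := fun u v => by
        have : (WithLp.toLp 2 ((0 : ℂ), u + v)) = WithLp.toLp 2 (0, u) + WithLp.toLp 2 (0, v) := by
          apply WithLp.ofLp_injective; apply Prod.ext <;> simp
        rw [this, map_add]; rfl
      map_smul' := fun a u => by
        have : (WithLp.toLp 2 ((0 : ℂ), a • u)) = a • WithLp.toLp 2 ((0 : ℂ), u) := by
          apply WithLp.ofLp_injective; apply Prod.ext <;> simp
        rw [this, map_smul]; rfl } 1 fun u => by
          refine (WithLp.norm_snd_le ℂ _).trans ((V.le_opNorm _).trans ?_)
          gcongr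
          simp
  let c : E := (V (WithLp.toLp 2 ((m : ℂ), 0))).snd
  have hD : ∀ u, (V (WithLp.toLp 2 ((m : ℂ), u))).snd = c + D u := by
    intro u
    have : (WithLp.toLp 2 ((m : ℂ), u)) = WithLp.toLp 2 ((m : ℂ), 0) + WithLp.toLp 2 (0, u) := by
      apply WithLp.ofLp_injective; apply Prod.ext <;> simp
    rw [this, map_add]; rfl
  have hDx : ∀ x : UnitBall d,
      ‖D.comp (rowSMulCLM (x : EuclideanSpace ℂ (Fin d)))‖ < 1 := by
    intro x
    have hx : ‖(x : EuclideanSpace ℂ (Fin d))‖ < 1 := mem_ball_zero_iff.mp x.2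
    refine lt_of_le_of_lt (ContinuousLinearMap.opNorm_comp_le _ _) (lt_of_le_of_lt ?_ hx)
    calc _ ≤ 1 * ‖(x : EuclideanSpace ℂ (Fin d))‖ :=
          mul_le_mul (LinearMap.mkContinuous_norm_le _ zero_le_one _)
            (LinearMap.mkContinuous_norm_le _ (norm_nonneg _) _) (norm_nonneg _) zero_le_one
      _ = _ := one_mul _
  -- The second component of `V p = q` reads `g x = c + D (l x ⊗ g x)`. This equation makes sense at
  -- every point of the ball and has a unique solution there, since `D` is a contraction and `‖x‖ <
  -- 1`.
  choose G hG hGu using fun x : UnitBall d =>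
    existsUnique_eq_add_apply (D.comp (rowSMulCLM (x : EuclideanSpace ℂ (Fin d)))) (hDx x) c
  let P : UnitBall d → WithLp 2 (ℂ × PiLp 2 fun _ : Fin d => E) :=
    fun x => WithLp.toLp 2 ((m : ℂ), rowSMul (x : EuclideanSpace ℂ (Fin d)) (G x))
  let ψ : UnitBall d → ℂ := fun x => (V (P x)).fst
  let Q : UnitBall d → WithLp 2 (ℂ × E) := fun x => WithLp.toLp 2 (ψ x, G x)
  have hPQ : ∀ x, V (P x) = Q x := by
    intro x
    apply WithLp.ofLp_injective
    exact Prod.ext rfl ((hD _).trans (hG x).symm)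
  -- Uniqueness of the solution is what makes `ψ` extend `φ`.
  have hGl : ∀ x, G (l x) = g x := by
    intro x
    refine (hGu (l x) (g x) ?_).symm
    have := congrArg (fun u : WithLp 2 (ℂ × E) => u.snd) (hVp x)
    exact this.symm.trans (hD _)
  refine ⟨ψ, fun x => ?_, ?_⟩
  · have h1 : P (l x) = p x := by simp only [P, p, hGl]
    simp only [ψ, h1, hVp]
    rfl
  -- Contractivity of `V` makes `m² - ψψ* - (1 - ⟨x, y⟩)⟨G x, G y⟩` positive. Take the Schur product
  -- with the Drury-Arveson kernel and add the Gram matrix of `G`.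
  · have h1 := (posSemidef_gram_sub_iff zero_le_one P Q).mpr (norm_sum_le_of_clm V hV hPQ)
    have h2 := (posSemidef_of_inner G).add (h1.hadamard (posSemidef_druryArvesonKernel d))
    refine h2.congr fun x y => ?_
    simp only [Matrix.of_apply, Matrix.add_apply, Matrix.hadamard_apply, P, Q,
      WithLp.prod_inner_apply, inner_rowSMul, druryArvesonKernel]
    have := hne x y
    field_simp
    simp [hm]
    ring

end Pick

/-! ### Laurent series on the annulus from Fourier series on circles. -/

open Real in
instance factTwoPiPos : Fact (0 < 2 * π) := ⟨Real.two_pi_pos⟩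

/-- The point of the circle `|z| = ρ` with argument `x`. -/
def circlePoint (ρ : ℝ) (x : AddCircle (2 * Real.pi)) : ℂ := ρ * (AddCircle.toCircle x : ℂ)

theorem norm_circlePoint {ρ : ℝ} (hρ : 0 ≤ ρ) (x : AddCircle (2 * Real.pi)) :
    ‖circlePoint ρ x‖ = ρ := by
  rw [circlePoint, norm_mul, Circle.norm_coe, mul_one, Complex.norm_real, Real.norm_of_nonneg hρ]

theorem continuous_circlePoint (ρ : ℝ) : Continuous (circlePoint ρ) := by
  unfold circlePoint
  have : Continuous (AddCircle.toCircle : AddCircle (2 * Real.pi) → Circle) :=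
    AddCircle.continuous_toCircle
  fun_prop

theorem circlePoint_coe (ρ θ : ℝ) : circlePoint ρ (θ : AddCircle (2 * Real.pi)) =
    circleMap 0 ρ θ := by
  simp [circlePoint, circleMap, AddCircle.toCircle_apply_mk]

theorem circlePoint_zpow (ρ : ℝ) (x : AddCircle (2 * Real.pi)) (n : ℤ) :
    circlePoint ρ x ^ n = (ρ : ℂ) ^ n * fourier n x := by
  rw [circlePoint, mul_zpow, fourier_apply, AddCircle.toCircle_zsmul, Circle.coe_zpow]

theorem exists_circlePoint_eq (z : ℂ) : ∃ x, circlePoint ‖z‖ x = z := by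
  refine ⟨(Complex.arg z : ℝ), ?_⟩
  rw [circlePoint_coe, circleMap_zero]
  exact Complex.norm_mul_exp_arg_mul_I z

theorem circlePoint_mem_annulus {r ρ : ℝ} (hρ : ρ ∈ Set.Ioo r 1) (h0 : 0 ≤ ρ)
    (x : AddCircle (2 * Real.pi)) : circlePoint ρ x ∈ annulus r := by
  simpa [annulus, norm_circlePoint h0] using hρ

theorem isOpen_annulus (r : ℝ) : IsOpen (annulus r) :=
  (isOpen_lt continuous_const continuous_norm).inter (isOpen_lt continuous_norm continuous_const)

theorem continuous_comp_circlePoint {r ρ : ℝ} {h : ℂ → ℂ} (hh : ContinuousOn h (annulus r))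
    (hρ : ρ ∈ Set.Ioo r 1) (h0 : 0 ≤ ρ) : Continuous fun x => h (circlePoint ρ x) :=
  hh.comp_continuous (continuous_circlePoint ρ) fun x => circlePoint_mem_annulus hρ h0 x

theorem fourierCoeff_comp_circlePoint {ρ : ℝ} (hρ : 0 < ρ) (h : ℂ → ℂ) (n : ℤ) :
    fourierCoeff (fun x => h (circlePoint ρ x)) n =
      (2 * Real.pi * Complex.I)⁻¹ * (∮ z in C(0, ρ), h z * z ^ (-n - 1)) * (ρ : ℂ) ^ n := by
  have hρ' : (ρ : ℂ) ≠ 0 := by exact_mod_cast hρ.ne'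
  have hpi : (Real.pi : ℂ) ≠ 0 := by exact_mod_cast Real.pi_ne_zero
  rw [fourierCoeff_eq_intervalIntegral _ n 0, circleIntegral, zero_add]
  have e : ∀ θ : ℝ, deriv (circleMap 0 ρ) θ • (h (circleMap 0 ρ θ) *
      circleMap 0 ρ θ ^ (-n - 1)) = (Complex.I * (ρ : ℂ) ^ (-n)) *
        (fourier (-n) (θ : AddCircle (2 * Real.pi)) • h (circlePoint ρ (θ : AddCircle _))) := by
    intro θ
    have hc : circleMap 0 ρ θ ≠ 0 := circleMap_ne_center hρ.ne'
    have h1 := circlePoint_zpow ρ (θ : AddCircle (2 * Real.pi)) (-n)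
    rw [circlePoint_coe] at h1
    rw [deriv_circleMap, zpow_sub₀ hc, h1, circlePoint_coe]
    simp only [smul_eq_mul, zpow_one]
    field_simp
  simp_rw [e]
  rw [intervalIntegral.integral_const_mul, zpow_neg]
  have hn : (ρ : ℂ) ^ n ≠ 0 := zpow_ne_zero _ hρ'
  have := Complex.I_ne_zero
  rw [Complex.real_smul]
  field_simp
  push_cast
  field_simp

/-- The Laurent coefficients of a holomorphic function on an annulus do not depend on the
circle. -/
theorem exists_laurentCoeff {r : ℝ} (hr0 : 0 ≤ r) (hr1 : r < 1) {h : ℂ → ℂ}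
    (hh : DifferentiableOn ℂ h (annulus r)) :
    ∃ a : ℤ → ℂ, ∀ ρ ∈ Set.Ioo r 1, ∀ n,
      fourierCoeff (fun x => h (circlePoint ρ x)) n = a n * (ρ : ℂ) ^ n := by
  -- Cauchy's theorem on the closed annulus between the two circles, where `h z * z ^ (-n - 1)` is
  -- holomorphic.
  have key : ∀ n : ℤ, ∀ ρ₁ ∈ Set.Ioo r 1, ∀ ρ₂ ∈ Set.Ioo r 1, ρ₁ ≤ ρ₂ →
      (∮ z in C(0, ρ₂), h z * z ^ (-n - 1)) = ∮ z in C(0, ρ₁), h z * z ^ (-n - 1) := by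
    intro n ρ₁ h₁ ρ₂ h₂ h12
    have hd : ∀ z ∈ annulus r, DifferentiableAt ℂ (fun z => h z * z ^ (-n - 1)) z := by
      intro z hz
      have hz0 : z ≠ 0 := norm_pos_iff.mp (hr0.trans_lt hz.1)
      exact (hh.differentiableAt ((isOpen_annulus r).mem_nhds hz)).mul
        (differentiableAt_zpow.mpr (Or.inl hz0))
    refine Complex.circleIntegral_eq_of_differentiable_on_annulus_off_countable
      (hr0.trans_lt h₁.1) h12 Set.countable_empty (fun z hz => ?_) (fun z hz => ?_)
    · refine (hd z ⟨?_, ?_⟩).continuousAt.continuousWithinAt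
      · have := hz.2
        simp only [Metric.mem_ball, dist_zero_right, not_lt] at this
        exact h₁.1.trans_le this
      · have := hz.1
        simp only [Metric.mem_closedBall, dist_zero_right] at this
        exact this.trans_lt h₂.2
    · refine hd z ⟨?_, ?_⟩
      · have := hz.1.2
        simp only [Metric.mem_closedBall, dist_zero_right, not_le] at this
        exact h₁.1.trans this
      · have := hz.1.1
        simp only [Metric.mem_ball, dist_zero_right] at this
        exact this.trans h₂.2
  have hm : (r + 1) / 2 ∈ Set.Ioo r 1 := ⟨by linarith, by linarith⟩
  refine ⟨fun n => (2 * Real.pi * Complex.I)⁻¹ *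
    ∮ z in C(0, (r + 1) / 2), h z * z ^ (-n - 1), fun ρ hρ n => ?_⟩
  rw [fourierCoeff_comp_circlePoint (hr0.trans_lt hρ.1)]
  rcases le_total ρ ((r + 1) / 2) with hle | hle
  · rw [← key n _ hρ _ hm hle]
  · rw [key n _ hm _ hρ hle]

theorem summable_pow_natAbs {q : ℝ} (h0 : 0 ≤ q) (h1 : q < 1) :
    Summable fun n : ℤ => q ^ n.natAbs := by
  refine Summable.of_nat_of_neg ?_ ?_ <;>
    simpa using summable_geometric_of_lt_one h0 h1

theorem zpow_le_pow_natAbs {q t : ℝ} (n : ℤ) (ht0 : 0 < t) (h1 : 0 ≤ n → t ≤ q)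
    (h2 : n < 0 → t⁻¹ ≤ q) : t ^ n ≤ q ^ n.natAbs := by
  rcases le_or_gt 0 n with hn | hn
  · obtain ⟨k, rfl⟩ := Int.eq_ofNat_of_zero_le hn
    simpa using pow_le_pow_left₀ ht0.le (h1 hn) k
  · obtain ⟨k, hk⟩ := Int.eq_ofNat_of_zero_le (neg_nonneg.mpr hn.le)
    obtain rfl : n = -(k : ℤ) := by omega
    have := pow_le_pow_left₀ (inv_nonneg.mpr ht0.le) (h2 hn) k
    simpa using this

theorem hasSum_sq_fourierCoeff_of_continuous {f : AddCircle (2 * Real.pi) → ℂ}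
    (hf : Continuous f) :
    HasSum (fun n => ‖fourierCoeff f n‖ ^ 2)
      (∫ x : AddCircle (2 * Real.pi), ‖f x‖ ^ 2 ∂AddCircle.haarAddCircle) := by
  have h := hasSum_sq_fourierCoeff (ContinuousMap.toLp (E := ℂ) 2 AddCircle.haarAddCircle ℂ ⟨f, hf⟩)
  simp_rw [fourierCoeff_toLp] at h
  rwa [MeasureTheory.integral_congr_ae (g := fun x => ‖f x‖ ^ 2)] at h
  filter_upwards [ContinuousMap.coeFn_toLp (p := 2) (𝕜 := ℂ) AddCircle.haarAddCircle
    (⟨f, hf⟩ : C(AddCircle (2 * Real.pi), ℂ))] with x hx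
  rw [hx]
  rfl

theorem exists_norm_fourierCoeff_le {f : AddCircle (2 * Real.pi) → ℂ} (hf : Continuous f) :
    ∃ C, ∀ n, ‖fourierCoeff f n‖ ≤ C := by
  refine ⟨√(∫ x : AddCircle (2 * Real.pi), ‖f x‖ ^ 2 ∂AddCircle.haarAddCircle), fun n => Real.le_sqrt_of_sq_le ?_⟩
  exact le_hasSum (hasSum_sq_fourierCoeff_of_continuous hf) n fun _ _ => by positivity

/-- The Laurent series of a holomorphic function on an annulus converges to it. -/
theorem hasSum_laurent {r : ℝ} (hr0 : 0 ≤ r) {h : ℂ → ℂ}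
    (hh : DifferentiableOn ℂ h (annulus r)) {a : ℤ → ℂ}
    (ha : ∀ ρ ∈ Set.Ioo r 1, ∀ n,
      fourierCoeff (fun x => h (circlePoint ρ x)) n = a n * (ρ : ℂ) ^ n) {z : ℂ}
    (hz : z ∈ annulus r) : HasSum (fun n => a n * z ^ n) (h z) := by
  obtain ⟨x, hx⟩ := exists_circlePoint_eq z
  have hz0 : 0 < ‖z‖ := hr0.trans_lt hz.1
  have hc : ∀ ρ ∈ Set.Ioo r 1, Continuous fun x => h (circlePoint ρ x) := fun ρ hρ =>
    continuous_comp_circlePoint hh.continuousOn hρ (hr0.trans hρ.1.le)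
  obtain ⟨ρ₁, h1⟩ := exists_between hz.1
  obtain ⟨ρ₂, h2⟩ := exists_between hz.2
  have h1' : ρ₁ ∈ Set.Ioo r 1 := ⟨h1.1, h1.2.trans hz.2⟩
  have h2' : ρ₂ ∈ Set.Ioo r 1 := ⟨hz.1.trans h2.1, h2.2⟩
  have hρ1 : 0 < ρ₁ := hr0.trans_lt h1.1
  have hρ2 : 0 < ρ₂ := hz0.trans h2.1
  have bound : ∀ ρ ∈ Set.Ioo r 1, ∃ C, ∀ n, ‖a n‖ * ρ ^ n ≤ C := by
    intro ρ hρ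
    obtain ⟨C, hC⟩ := exists_norm_fourierCoeff_le (hc ρ hρ)
    refine ⟨C, fun n => ?_⟩
    have := hC n
    rwa [ha ρ hρ, norm_mul, norm_zpow, Complex.norm_real, Real.norm_eq_abs,
      abs_of_pos (hr0.trans_lt hρ.1)] at this
  obtain ⟨C₁, hC₁⟩ := bound ρ₁ h1'
  obtain ⟨C₂, hC₂⟩ := bound ρ₂ h2'
  -- Comparing with the bounded coefficients on the outer circle for `n ≥ 0` and on the inner circle
  -- for `n < 0` gives decay like `q ^ |n|`. Hence the Fourier series on `|z|` converges absolutely.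
  set q := max (‖z‖ / ρ₂) (ρ₁ / ‖z‖)
  have hq1 : q < 1 := max_lt ((div_lt_one hρ2).mpr h2.1) ((div_lt_one hz0).mpr h1.2)
  have hq0 : 0 ≤ q := le_max_of_le_left (by positivity)
  have hs : Summable fun n => ‖a n‖ * ‖z‖ ^ n := by
    refine Summable.of_nonneg_of_le (fun n => by positivity) (fun n => ?_)
      ((summable_pow_natAbs hq0 hq1).mul_left (max C₁ C₂))
    have hM : 0 ≤ max C₁ C₂ := le_max_of_le_left ((by positivity : 0 ≤ ‖a 0‖ * ρ₁ ^ (0 : ℤ)).trans (hC₁ 0))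
    rcases le_or_gt 0 n with hn | hn
    · calc ‖a n‖ * ‖z‖ ^ n = ‖a n‖ * ρ₂ ^ n * (‖z‖ / ρ₂) ^ n := by
            rw [div_zpow]; field_simp
        _ ≤ max C₁ C₂ * q ^ n.natAbs := by
            refine mul_le_mul ((hC₂ n).trans (le_max_right _ _)) ?_ (by positivity) hM
            exact zpow_le_pow_natAbs n (by positivity) (fun _ => le_max_left _ _) (by omega)
    · calc ‖a n‖ * ‖z‖ ^ n = ‖a n‖ * ρ₁ ^ n * (‖z‖ / ρ₁) ^ n := by
            rw [div_zpow]; field_simp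
        _ ≤ max C₁ C₂ * q ^ n.natAbs := by
            refine mul_le_mul ((hC₁ n).trans (le_max_left _ _)) ?_ (by positivity) hM
            refine zpow_le_pow_natAbs n (by positivity) (by omega) (fun _ => ?_)
            rw [inv_div]
            exact le_max_right _ _
  have hcz := hc ‖z‖ hz
  have hcoeff : fourierCoeff (fun x => h (circlePoint ‖z‖ x)) = fun n => a n * (‖z‖ : ℂ) ^ n :=
    funext (ha ‖z‖ hz)
  have hsum : Summable (fourierCoeff (⟨_, hcz⟩ : C(AddCircle (2 * Real.pi), ℂ))) := by
    refine Summable.of_norm ?_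
    simp only [ContinuousMap.coe_mk, hcoeff, norm_mul, norm_zpow, Complex.norm_real, norm_norm]
    exact hs
  have hfin := has_pointwise_sum_fourier_series_of_summable hsum x
  simp only [ContinuousMap.coe_mk, hcoeff, hx, smul_eq_mul] at hfin
  convert hfin using 2 with n
  rw [mul_assoc, ← circlePoint_zpow, hx]

/-- Uniqueness of the coefficients of an absolutely convergent Laurent series. -/
theorem fourierCoeff_of_hasSum {ρ : ℝ} (hρ : 0 ≤ ρ) {h : ℂ → ℂ} {a : ℤ → ℂ}
    (ha : Summable fun n => ‖a n‖ * ρ ^ n)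
    (hh : ∀ x, HasSum (fun n => a n * circlePoint ρ x ^ n) (h (circlePoint ρ x))) (m : ℤ) :
    fourierCoeff (fun x => h (circlePoint ρ x)) m = a m * (ρ : ℂ) ^ m := by
  have e : (fun x => h (circlePoint ρ x)) = fun x => ∑' n, (a n * (ρ : ℂ) ^ n) * fourier n x := by
    funext x
    rw [← (hh x).tsum_eq]
    simp_rw [circlePoint_zpow, mul_assoc]
  have hint : ∀ n : ℤ, MeasureTheory.Integrable (fun x : AddCircle (2 * Real.pi) =>
      fourier (-m) x • ((a n * (ρ : ℂ) ^ n) * fourier n x)) AddCircle.haarAddCircle := by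
    intro n
    refine Continuous.integrable_of_hasCompactSupport (by fun_prop) (HasCompactSupport.of_compactSpace _)
  have hn : ∀ (n : ℤ) (x : AddCircle (2 * Real.pi)),
      ‖fourier (-m) x • ((a n * (ρ : ℂ) ^ n) * fourier n x)‖ = ‖a n‖ * ρ ^ n := by
    intro n x
    simp only [fourier_apply, norm_smul, norm_mul, Circle.norm_coe, norm_zpow, Complex.norm_real,
      Real.norm_of_nonneg hρ, one_mul, mul_one]
  have hs := MeasureTheory.hasSum_integral_of_summable_integral_norm hint (by
    simpa only [hn, MeasureTheory.integral_const, MeasureTheory.probReal_univ, one_smul] using ha)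
  have hcoef : ∀ n : ℤ, (∫ x : AddCircle (2 * Real.pi),
      fourier (-m) x • ((a n * (ρ : ℂ) ^ n) * fourier n x) ∂AddCircle.haarAddCircle) =
      if n = m then a n * (ρ : ℂ) ^ n else 0 := by
    intro n
    have h1 := fourierCoeff.const_mul (fourier (T := 2 * Real.pi) n) (a n * (ρ : ℂ) ^ n) m
    rw [fourierCoeff_fourier] at h1
    rw [fourierCoeff] at h1
    rw [h1]
    by_cases hnm : n = m
    · subst hnm; simp
    · simp [hnm, Ne.symm hnm]
  simp_rw [hcoef] at hs
  have hm : HasSum (fun n : ℤ => if n = m then a n * (ρ : ℂ) ^ n else 0) (a m * (ρ : ℂ) ^ m) := by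
    convert hasSum_single m (f := fun n : ℤ => if n = m then a n * (ρ : ℂ) ^ n else 0)
      (fun n hn => if_neg hn) using 1
    simp
  rw [fourierCoeff, ← hs.unique hm]
  congr 1
  funext x
  have := congrFun e x
  rw [this, smul_eq_mul, ← tsum_mul_left]
  rfl

/-! ### Multiplication in the Hardy norm, by Parseval on circles. -/

theorem summable_sq_of_summable {ι : Type*} {f : ι → ℝ} (h0 : ∀ i, 0 ≤ f i) (hf : Summable f) :
    Summable fun i => f i ^ 2 := by
  refine Summable.of_nonneg_of_le (fun i => by positivity) (fun i => ?_) (hf.mul_left (∑' i, f i))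
  rw [sq]
  exact mul_le_mul_of_nonneg_right (hf.le_tsum i fun j _ => h0 j) (h0 i)

theorem zpow_le_max {r ρ : ℝ} (hr : 0 < r) (hρ : ρ ∈ Set.Icc r 1) (n : ℤ) :
    ρ ^ n ≤ max 1 (r ^ n) := by
  have hρ0 : 0 < ρ := hr.trans_le hρ.1
  rcases le_or_gt 0 n with hn | hn
  · obtain ⟨k, rfl⟩ := Int.eq_ofNat_of_zero_le hn
    exact le_max_of_le_left (by simpa using pow_le_one₀ hρ0.le hρ.2)
  · obtain ⟨k, hk⟩ := Int.eq_ofNat_of_zero_le (neg_nonneg.mpr hn.le)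
    obtain rfl : n = -(k : ℤ) := by omega
    refine le_max_of_le_right ?_
    rw [zpow_neg, zpow_neg, zpow_natCast, zpow_natCast]
    have := hρ.1
    gcongr

/-- Multiplication by a bounded holomorphic function on the annulus, in terms of Laurent
coefficients, for the Hardy space norm `∑ |g n|² (1 + r²ⁿ)`. -/
theorem exists_laurentCoeff_mul {r : ℝ} (hr0 : 0 < r) (hr1 : r < 1) {φ : ℂ → ℂ} {M : ℝ}
    (hφ : DifferentiableOn ℂ φ (annulus r)) (hM : ∀ z ∈ annulus r, ‖φ z‖ ≤ M)
    {g : ℤ → ℂ} (hg : Summable fun n => ‖g n‖ * max 1 (r ^ n)) :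
    ∃ h : ℤ → ℂ, (∀ z ∈ annulus r, HasSum (fun n => h n * z ^ n) (φ z * ∑' n, g n * z ^ n)) ∧
      ∀ s : Finset ℤ, ∑ n ∈ s, ‖h n‖ ^ 2 * (1 + (r ^ n) ^ 2) ≤
        M ^ 2 * ∑' n, ‖g n‖ ^ 2 * (1 + (r ^ n) ^ 2) := by
  set G : ℂ → ℂ := fun z => ∑' n, g n * z ^ n
  have hterm : ∀ n, ∀ ρ ∈ Set.Icc r 1, ‖g n‖ * ρ ^ n ≤ ‖g n‖ * max 1 (r ^ n) := fun n ρ hρ =>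
    mul_le_mul_of_nonneg_left (zpow_le_max hr0 hρ n) (norm_nonneg _)
  have hsρ : ∀ ρ ∈ Set.Icc r 1, Summable fun n => ‖g n‖ * ρ ^ n := fun ρ hρ =>
    Summable.of_nonneg_of_le
      (fun n => mul_nonneg (norm_nonneg _) (zpow_nonneg (hr0.le.trans hρ.1) _))
      (fun n => hterm n ρ hρ) hg
  have hsG : ∀ z ∈ annulus r, HasSum (fun n => g n * z ^ n) (G z) := by
    intro z hz
    refine (Summable.of_norm ?_).hasSum
    simpa using hsρ ‖z‖ ⟨hz.1.le, hz.2.le⟩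
  have hGd : DifferentiableOn ℂ G (annulus r) := by
    refine Complex.differentiableOn_tsum_of_summable_norm hg (fun n => ?_) (isOpen_annulus r)
      (fun n z hz => ?_)
    · intro z hz
      have hz0 : z ≠ 0 := norm_pos_iff.mp (hr0.trans hz.1)
      exact ((differentiableAt_zpow.mpr (Or.inl hz0)).const_mul _).differentiableWithinAt
    · rw [norm_mul, norm_zpow]
      exact hterm n ‖z‖ ⟨hz.1.le, hz.2.le⟩
  have hd : DifferentiableOn ℂ (fun z => φ z * G z) (annulus r) := hφ.mul hGd
  obtain ⟨h, hh⟩ := exists_laurentCoeff hr0.le hr1 hd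
  refine ⟨h, fun z hz => hasSum_laurent hr0.le hd hh hz, fun s => ?_⟩
  -- Parseval for `φ G` and for `G` on the circle of radius `ρ`, with `‖φ‖ ≤ M` in between.
  have hIoo : ∀ ρ ∈ Set.Ioo r 1, ∑ n ∈ s, ‖h n‖ ^ 2 * (ρ ^ n) ^ 2 ≤
      M ^ 2 * ∑' n, ‖g n‖ ^ 2 * (ρ ^ n) ^ 2 := by
    intro ρ hρ
    have hρ0 : 0 < ρ := hr0.trans hρ.1
    have hc1 := continuous_comp_circlePoint hd.continuousOn hρ hρ0.le
    have hc2 := continuous_comp_circlePoint hGd.continuousOn hρ hρ0.le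
    have p1 := hasSum_sq_fourierCoeff_of_continuous hc1
    have p2 := hasSum_sq_fourierCoeff_of_continuous hc2
    have hGc := fourierCoeff_of_hasSum hρ0.le (hsρ ρ ⟨hρ.1.le, hρ.2.le⟩)
      (fun x => hsG _ (circlePoint_mem_annulus hρ hρ0.le x))
    simp only [hh ρ hρ, hGc, norm_mul, norm_zpow, Complex.norm_real, Real.norm_of_nonneg hρ0.le,
      mul_pow] at p1 p2
    rw [p2.tsum_eq]
    refine (sum_le_hasSum s (fun n _ => by positivity) p1).trans ?_
    rw [← MeasureTheory.integral_const_mul]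
    refine MeasureTheory.integral_mono ?_ ?_ fun x => ?_
    · refine Continuous.integrable_of_hasCompactSupport ?_ (HasCompactSupport.of_compactSpace _)
      simp_rw [← mul_pow, ← norm_mul]
      fun_prop
    · exact Continuous.integrable_of_hasCompactSupport (continuous_const.mul (hc2.norm.pow 2))
        (HasCompactSupport.of_compactSpace _)
    · simp only
      gcongr
      exact hM _ (circlePoint_mem_annulus hρ hρ0.le x)
  have hs2 : Summable fun n => ‖g n‖ ^ 2 * max 1 (r ^ n) ^ 2 := by
    simpa only [mul_pow] using summable_sq_of_summable (fun n => by positivity) hg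
  have hcl : closure (Set.Ioo r 1) = Set.Icc r 1 := closure_Ioo hr1.ne
  have hzc : ∀ n : ℤ, ContinuousOn (fun ρ : ℝ => ρ ^ n) (Set.Icc r 1) := fun n ρ hρ =>
    (continuousAt_zpow₀ ρ n (Or.inl (hr0.trans_le hρ.1).ne')).continuousWithinAt
  have hbd : ∀ (n : ℤ), ∀ ρ ∈ Set.Icc r 1,
      ‖g n‖ ^ 2 * (ρ ^ n) ^ 2 ≤ ‖g n‖ ^ 2 * max 1 (r ^ n) ^ 2 := by
    intro n ρ hρ
    have h0 : 0 ≤ ρ ^ n := zpow_nonneg (hr0.le.trans hρ.1) _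
    gcongr
    exact zpow_le_max hr0 hρ n
  -- Passage to the boundary radii without boundary values of `φ`: the left side is a finite sum and
  -- the right side a uniformly convergent series, so both are continuous in `ρ` up to the
  -- endpoints. Adding the cases `ρ = r` and `ρ = 1` gives the Hardy norm.
  have hIcc : ∀ ρ ∈ Set.Icc r 1, ∑ n ∈ s, ‖h n‖ ^ 2 * (ρ ^ n) ^ 2 ≤
      M ^ 2 * ∑' n, ‖g n‖ ^ 2 * (ρ ^ n) ^ 2 := by
    intro ρ hρ
    refine le_on_closure hIoo ?_ ?_ (hcl ▸ hρ) <;> rw [hcl]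
    · exact continuousOn_finsetSum _ fun n _ => continuousOn_const.mul ((hzc n).pow 2)
    · refine continuousOn_const.mul (continuousOn_tsum
        (fun n => continuousOn_const.mul ((hzc n).pow 2)) hs2 fun n ρ hρ => ?_)
      rw [Real.norm_of_nonneg (by positivity)]
      exact hbd n ρ hρ
  have hr := hIcc r ⟨le_rfl, hr1.le⟩
  have h1 := hIcc 1 ⟨hr1.le, le_rfl⟩
  have s1 : Summable fun n => ‖g n‖ ^ 2 * ((1 : ℝ) ^ n) ^ 2 :=
    Summable.of_nonneg_of_le (fun n => by positivity) (fun n => hbd n 1 ⟨hr1.le, le_rfl⟩) hs2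
  have sr : Summable fun n => ‖g n‖ ^ 2 * (r ^ n) ^ 2 :=
    Summable.of_nonneg_of_le (fun n => by positivity) (fun n => hbd n r ⟨le_rfl, hr1.le⟩) hs2
  simp only [one_zpow, one_pow] at h1 s1
  simp_rw [mul_add]
  rw [Finset.sum_add_distrib, Summable.tsum_add s1 sr, mul_add]
  exact add_le_add h1 hr

/-! ### Weighted Laurent kernels and the Hardy multiplier bound. -/

theorem HasSum.of_forall_eq {ι : Type*} {f g : ι → ℂ} {a : ℂ} (hf : HasSum f a)
    (h : ∀ i, g i = f i) : HasSum g a :=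
  (funext h : g = f) ▸ hf

theorem summable_zpow_div_max {r : ℝ} (hr0 : 0 < r) {z : ℂ} (hz : z ∈ annulus r) :
    Summable fun n : ℤ => ‖z‖ ^ n / max 1 (r ^ n) := by
  have hz0 : 0 < ‖z‖ := hr0.trans hz.1
  set q := max ‖z‖ (r / ‖z‖)
  have hq1 : q < 1 := max_lt hz.2 ((div_lt_one hz0).mpr hz.1)
  have hq0 : 0 ≤ q := le_max_of_le_left hz0.le
  refine Summable.of_nonneg_of_le (fun n => by positivity) (fun n => ?_)
    (summable_pow_natAbs hq0 hq1)
  rcases le_or_gt 0 n with hn | hn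
  · exact (div_le_self (by positivity) (le_max_left _ _)).trans
      (zpow_le_pow_natAbs n hz0 (fun _ => le_max_left _ _) (by omega))
  · calc ‖z‖ ^ n / max 1 (r ^ n) ≤ ‖z‖ ^ n / r ^ n := by
          gcongr
          exact le_max_right _ _
      _ = (‖z‖ / r) ^ n := (div_zpow _ _ _).symm
      _ ≤ _ := zpow_le_pow_natAbs n (by positivity) (by omega) (fun _ => by
          rw [inv_div]; exact le_max_right _ _)

/-- The reciprocals of the squared norms of `zⁿ` in the space with kernel
`1 / ((1 - t) (1 - r² / t))`, `t = z * conj w`, up to a constant. -/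
def maxWeight (r : ℝ) (n : ℤ) : ℝ := (max 1 (r ^ n) ^ 2)⁻¹

/-- The reciprocals of the squared norms of `zⁿ` in the Hardy space of the annulus. -/
def hardyWeight (r : ℝ) (n : ℤ) : ℝ := (1 + (r ^ n) ^ 2)⁻¹

theorem hardyWeight_le_maxWeight {r : ℝ} (hr0 : 0 < r) (n : ℤ) :
    hardyWeight r n ≤ maxWeight r n := by
  unfold hardyWeight maxWeight
  have h := zpow_pos hr0 n
  gcongr
  rcases max_cases 1 (r ^ n) with h1 | h1 <;> rw [h1.1] <;> nlinarith

theorem maxWeight_le_two_mul_hardyWeight {r : ℝ} (hr0 : 0 < r) (n : ℤ) :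
    maxWeight r n ≤ 2 * hardyWeight r n := by
  unfold hardyWeight maxWeight
  have h := zpow_pos hr0 n
  rw [← div_eq_mul_inv, inv_le_comm₀ (by positivity) (by positivity), inv_div, div_le_iff₀ two_pos]
  rcases max_cases 1 (r ^ n) with h1 | h1 <;> rw [h1.1] <;> nlinarith

theorem summable_maxWeight_mul {r : ℝ} (hr0 : 0 < r) {z : ℂ} (hz : z ∈ annulus r) :
    Summable fun n : ℤ => maxWeight r n * (‖z‖ ^ n) ^ 2 := by
  convert summable_sq_of_summable (fun n => by positivity) (summable_zpow_div_max hr0 hz) using 2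
  rw [maxWeight, div_pow]
  field_simp

theorem exists_laurentVec {r : ℝ} {d : ℤ → ℝ} (hd0 : ∀ n, 0 ≤ d n)
    (hd : ∀ z ∈ annulus r, Summable fun n : ℤ => d n * (‖z‖ ^ n) ^ 2) :
    ∃ v : annulus r → lp (fun _ : ℤ => ℂ) 2, ∀ z n, v z n = (√(d n) : ℂ) * (z : ℂ) ^ n := by
  refine ⟨fun z => ⟨fun n => (√(d n) : ℂ) * (z : ℂ) ^ n, ?_⟩, fun z n => rfl⟩
  refine memℓp_gen ?_
  convert hd z z.2 using 2 with n
  simp [mul_pow, Real.sq_sqrt (hd0 n)]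

theorem hasSum_inner_laurentVec {r : ℝ} {d : ℤ → ℝ} (hd0 : ∀ n, 0 ≤ d n)
    {v : annulus r → lp (fun _ : ℤ => ℂ) 2} (hv : ∀ z n, v z n = (√(d n) : ℂ) * (z : ℂ) ^ n)
    (z w : annulus r) :
    HasSum (fun n => (d n : ℂ) * ((z : ℂ) * star (w : ℂ)) ^ n) (inner ℂ (v w) (v z)) := by
  refine HasSum.of_forall_eq (lp.hasSum_inner (𝕜 := ℂ) (v w) (v z)) fun n => ?_
  rw [hv, hv, mul_zpow]
  have : (d n : ℂ) = (√(d n) : ℂ) * (√(d n) : ℂ) := by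
    rw [← Complex.ofReal_mul, Real.mul_self_sqrt (hd0 n)]
  rw [this]
  simp
  ring

theorem coe_sum_laurentVec {r : ℝ} {d : ℤ → ℝ}
    {v : annulus r → lp (fun _ : ℤ => ℂ) 2} (hv : ∀ z n, v z n = (√(d n) : ℂ) * (z : ℂ) ^ n)
    (w : annulus r →₀ ℂ) (φ : ℂ → ℂ) (n : ℤ) :
    (w.sum fun x a => a • φ x • v x) n = √(d n) * w.sum fun x a => a * φ x * (x : ℂ) ^ n := by
  simp only [Finsupp.sum, Finset.mul_sum]
  rw [lp.coeFn_sum, Finset.sum_apply]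
  refine Finset.sum_congr rfl fun x _ => ?_
  rw [lp.coeFn_smul, Pi.smul_apply, lp.coeFn_smul, Pi.smul_apply, hv]
  simp only [smul_eq_mul]
  ring

/-- A bounded holomorphic function multiplies the Hardy space of the annulus contractively, up to
its supremum norm, stated for the adjoint on kernel vectors. -/
theorem norm_sum_smul_laurentVec_le {r : ℝ} (hr0 : 0 < r) (hr1 : r < 1) {φ : ℂ → ℂ} {M : ℝ}
    (hM0 : 0 ≤ M)
    (hφ : DifferentiableOn ℂ φ (annulus r)) (hM : ∀ z ∈ annulus r, ‖φ z‖ ≤ M)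
    {v : annulus r → lp (fun _ : ℤ => ℂ) 2}
    (hv : ∀ z n, v z n = (√(hardyWeight r n) : ℂ) * (z : ℂ) ^ n) (w : annulus r →₀ ℂ) :
    ‖w.sum fun x a => a • φ x • v x‖ ≤ M * ‖w.sum fun x a => a • v x‖ := by
  set u := w.sum fun x a => a • φ x • v x with hu
  set t := w.sum fun x a => a • v x with ht
  have hω : ∀ n : ℤ, 0 < 1 + (r ^ n) ^ 2 := fun n => by positivity
  have hd0 : ∀ n, 0 < hardyWeight r n := fun n => inv_pos.mpr (hω n)
  set σ : ℤ → ℂ := fun n => w.sum fun x a => a * φ x * (x : ℂ) ^ n with hσ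
  set τ : ℤ → ℂ := fun n => w.sum fun x a => a * (x : ℂ) ^ n with hτ
  have hun : ∀ n, u n = √(hardyWeight r n) * σ n := coe_sum_laurentVec hv w φ
  have htn : ∀ n, t n = √(hardyWeight r n) * τ n := by
    intro n
    have := coe_sum_laurentVec hv w (fun _ => 1) n
    simpa using this
  -- Duality: `g` holds the Laurent coefficients of the Hardy space function corresponding to `u`,
  -- with `∑ ‖g n‖² (1 + r²ⁿ) = ‖u‖²`. The bound on `u` will come from multiplying this function by
  -- `φ`.
  set g : ℤ → ℂ := fun n => star (σ n) * hardyWeight r n with hgdef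
  have hg : Summable fun n => ‖g n‖ * max 1 (r ^ n) := by
    have hb : Summable fun n : ℤ => w.sum fun x a => 2 * ‖a * φ x‖ * (‖(x : ℂ)‖ ^ n / max 1 (r ^ n)) :=
      summable_sum fun x _ => (summable_zpow_div_max hr0 x.2).mul_left _
    refine Summable.of_nonneg_of_le (fun n => by positivity) (fun n => ?_) hb
    have h1 : ‖σ n‖ ≤ w.sum fun x a => ‖a * φ x‖ * ‖(x : ℂ)‖ ^ n := by
      refine (norm_sum_le _ _).trans (Finset.sum_le_sum fun x _ => ?_)
      rw [norm_mul, norm_zpow]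
    have h2 : hardyWeight r n * max 1 (r ^ n) ≤ 2 / max 1 (r ^ n) := by
      rw [hardyWeight, inv_mul_eq_div, div_le_div_iff₀ (hω n) (by positivity)]
      have h := zpow_pos hr0 n
      rcases max_cases 1 (r ^ n) with h1 | h1 <;> rw [h1.1] <;> nlinarith
    calc ‖g n‖ * max 1 (r ^ n) = ‖σ n‖ * (hardyWeight r n * max 1 (r ^ n)) := by
          simp only [hgdef, norm_mul, norm_star, Complex.norm_real,
            Real.norm_of_nonneg (hd0 n).le]
          ring
      _ ≤ (w.sum fun x a => ‖a * φ x‖ * ‖(x : ℂ)‖ ^ n) * (2 / max 1 (r ^ n)) :=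
          mul_le_mul h1 h2 (mul_nonneg (hd0 n).le (by positivity)) ((norm_nonneg _).trans h1)
      _ = _ := by
          simp only [Finsupp.sum, Finset.sum_mul]
          refine Finset.sum_congr rfl fun x _ => ?_
          ring
  obtain ⟨h, hh, hhs⟩ := exists_laurentCoeff_mul hr0 hr1 hφ hM hg
  have hsq : ∀ n, (√(hardyWeight r n)) ^ 2 = hardyWeight r n := fun n => Real.sq_sqrt (hd0 n).le
  have hgu : ∀ n, ‖g n‖ ^ 2 * (1 + (r ^ n) ^ 2) = ‖u n‖ ^ 2 := by
    intro n
    rw [hun]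
    simp only [hgdef, norm_mul, norm_star, Complex.norm_real, Real.norm_eq_abs, mul_pow, sq_abs, hsq]
    rw [hardyWeight]
    have := (hω n).ne'
    field_simp
  have hunorm : HasSum (fun n => ‖u n‖ ^ 2) (‖u‖ ^ 2) := by
    simpa using lp.hasSum_norm (p := 2) (by norm_num) u
  have hηs : ∀ s : Finset ℤ, ∑ n ∈ s, ‖star (h n) * (√(1 + (r ^ n) ^ 2) : ℂ)‖ ^ 2 ≤
      (M * ‖u‖) ^ 2 := by
    intro s
    have := hhs s
    simp_rw [hgu] at this
    rw [hunorm.tsum_eq, ← mul_pow] at this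
    convert this using 2 with n
    simp only [norm_mul, norm_star, Complex.norm_real, Real.norm_eq_abs, mul_pow, sq_abs,
      Real.sq_sqrt (hω n).le]
  have hmem : Memℓp (fun n : ℤ => star (h n) * (√(1 + (r ^ n) ^ 2) : ℂ)) 2 := by
    refine memℓp_gen ?_
    simpa using summable_of_sum_le (fun n => by positivity) hηs
  set η : lp (fun _ : ℤ => ℂ) 2 := ⟨_, hmem⟩ with hη
  have hηx : ∀ n, η n = star (h n) * (√(1 + (r ^ n) ^ 2) : ℂ) := fun n => rfl
  have hηn : ‖η‖ ≤ M * ‖u‖ := by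
    refine lp.norm_le_of_forall_sum_le (by norm_num) (by positivity) fun s => ?_
    simpa [hηx] using hηs s
  -- Here `η` represents `φ g`. Both sides equal `∑ a φ(x) g(x)`: pairing `φ g` with `t` and pairing
  -- `g` with `u` evaluate the same functions at the points `x`. Cauchy-Schwarz and `‖η‖ ≤ M ‖u‖`
  -- then finish.
  have key : (inner ℂ η t : ℂ) = ((‖u‖ ^ 2 : ℝ) : ℂ) := by
    have s1 : HasSum (fun n => h n * τ n) (inner ℂ η t) := by
      refine HasSum.of_forall_eq (lp.hasSum_inner (𝕜 := ℂ) η t) fun n => ?_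
      rw [htn]
      have e : (√(1 + (r ^ n) ^ 2) : ℂ) * (√(hardyWeight r n) : ℂ) = 1 := by
        rw [← Complex.ofReal_mul, hardyWeight, Real.sqrt_inv,
          mul_inv_cancel₀ (Real.sqrt_pos.mpr (hω n)).ne', Complex.ofReal_one]
      simp only [hηx, RCLike.inner_apply, map_mul, Complex.conj_ofReal, RCLike.star_def,
        Complex.conj_conj]
      linear_combination (- h n * τ n) * e
    have s2 : HasSum (fun n => h n * τ n)
        (w.sum fun x a => a * (φ x * ∑' n, g n * (x : ℂ) ^ n)) := by
      simp only [hτ, Finsupp.sum, Finset.mul_sum]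
      refine hasSum_sum fun x _ => ?_
      refine HasSum.of_forall_eq ((hh x x.2).mul_left (w x)) fun n => ?_
      ring
    have hgx : ∀ x : annulus r, HasSum (fun n => g n * (x : ℂ) ^ n) (∑' n, g n * (x : ℂ) ^ n) := by
      intro x
      refine (Summable.of_norm (Summable.of_nonneg_of_le (fun n => norm_nonneg _)
        (fun n => ?_) hg)).hasSum
      rw [norm_mul, norm_zpow]
      exact mul_le_mul_of_nonneg_left (zpow_le_max hr0 ⟨x.2.1.le, x.2.2.le⟩ n) (norm_nonneg _)
    have s3 : HasSum (fun n => g n * σ n)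
        (w.sum fun x a => a * (φ x * ∑' n, g n * (x : ℂ) ^ n)) := by
      simp only [hσ, Finsupp.sum, Finset.mul_sum]
      refine hasSum_sum fun x _ => ?_
      refine HasSum.of_forall_eq (((hgx x).mul_left (φ x)).mul_left (w x)) fun n => ?_
      ring
    have s4 : HasSum (fun n => g n * σ n) ((‖u‖ ^ 2 : ℝ) : ℂ) := by
      refine HasSum.of_forall_eq (Complex.hasSum_ofReal.mpr hunorm) fun n => ?_
      rw [hun, norm_mul, mul_pow, Complex.norm_real, Real.norm_eq_abs, sq_abs, hsq]
      push_cast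
      rw [← Complex.conj_mul']
      simp only [hgdef, RCLike.star_def]
      ring
    rw [s1.unique s2, s3.unique s4]
  have hfin : ‖u‖ ^ 2 ≤ M * ‖u‖ * ‖t‖ := by
    have := norm_inner_le_norm (𝕜 := ℂ) η t
    rw [key, Complex.norm_real, Real.norm_of_nonneg (by positivity)] at this
    exact this.trans (by gcongr)
  rcases (norm_nonneg u).eq_or_lt with h0 | h0
  · rw [← h0]
    positivity
  · nlinarith

/-! ### The restricted Drury-Arveson kernel and the upper bound. -/

theorem maxWeight_natCast {r : ℝ} (hr0 : 0 < r) (hr1 : r < 1) (k : ℕ) : maxWeight r k = 1 := by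
  have : r ^ (k : ℤ) ≤ 1 := by simpa using pow_le_one₀ hr0.le hr1.le
  rw [maxWeight, max_eq_left this]
  simp

theorem maxWeight_neg_natCast {r : ℝ} (hr0 : 0 < r) (hr1 : r < 1) (k : ℕ) :
    maxWeight r (-(k : ℤ)) = (r ^ 2) ^ k := by
  have : 1 ≤ r ^ (-(k : ℤ)) := by
    rw [zpow_neg, zpow_natCast]
    exact (one_le_inv₀ (by positivity)).mpr (pow_le_one₀ hr0.le hr1.le)
  rw [maxWeight, max_eq_right this, zpow_neg, zpow_natCast, inv_pow, inv_inv, ← pow_mul, ← pow_mul,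
    mul_comm]

theorem inner_annulusToBall {r : ℝ} (hr0 : 0 < r) (z w : annulus r) :
    (inner ℂ (annulusToBall r hr0 w : EuclideanSpace ℂ (Fin 2))
      (annulusToBall r hr0 z : EuclideanSpace ℂ (Fin 2)) : ℂ) =
      ((z : ℂ) * star (w : ℂ) + r ^ 2 / ((z : ℂ) * star (w : ℂ))) / (r ^ 2 + 1) := by
  have hs : ((√(r ^ 2 + 1) : ℝ) : ℂ) * ((√(r ^ 2 + 1) : ℝ) : ℂ) = r ^ 2 + 1 := by
    rw [← Complex.ofReal_mul, Real.mul_self_sqrt (by positivity)]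
    push_cast
    rfl
  have hs0 : ((√(r ^ 2 + 1) : ℝ) : ℂ) ≠ 0 := by
    exact_mod_cast (Real.sqrt_pos.mpr (by positivity)).ne'
  have hz : (z : ℂ) ≠ 0 := norm_pos_iff.mp (hr0.trans z.2.1)
  have hw : star (w : ℂ) ≠ 0 := star_ne_zero.mpr (norm_pos_iff.mp (hr0.trans w.2.1))
  rw [← hs]
  simp only [annulusToBall, PiLp.inner_apply, Fin.sum_univ_two, RCLike.inner_apply,
    Matrix.cons_val_zero, Matrix.cons_val_one, map_mul, map_div₀, Complex.conj_ofReal, map_one]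
  simp only [RCLike.star_def] at hw ⊢
  field_simp

/-- The denominator factors as `(1 - t)(1 - s²/t) / (1 + s²)`; the rest is partial fractions. The
two terms expand into the nonnegative and the negative powers of `t`. -/
theorem annulus_kernel_eq {t s : ℂ} (ht : t ≠ 0) (h1 : 1 - t ≠ 0) (h2 : 1 - s ^ 2 / t ≠ 0)
    (hs : s ^ 2 + 1 ≠ 0) :
    (1 - s ^ 2) / (1 + s ^ 2) * (1 / (1 - (t + s ^ 2 / t) / (s ^ 2 + 1))) =
      (1 - t)⁻¹ + (1 - s ^ 2 / t)⁻¹ * (s ^ 2 / t) := by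
  have h3 : t - s ^ 2 ≠ 0 := by
    intro h0
    apply h2
    rw [← sub_eq_zero.mp h0, div_self ht, sub_self]
  have e1 : 1 - (t + s ^ 2 / t) / (s ^ 2 + 1) =
      (1 - t) * (t - s ^ 2) / (t * (s ^ 2 + 1)) := by
    field_simp
    ring
  have e2 : 1 - s ^ 2 / t = (t - s ^ 2) / t := by field_simp
  rw [e1, e2, add_comm (1 : ℂ) (s ^ 2)]
  field_simp
  ring

/-- The Drury-Arveson kernel on the embedded annulus as a Laurent series. -/
theorem hasSum_maxWeight {r : ℝ} (hr0 : 0 < r) (hr1 : r < 1) (z w : annulus r) :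
    HasSum (fun n => (maxWeight r n : ℂ) * ((z : ℂ) * star (w : ℂ)) ^ n)
      ((((1 - r ^ 2) / (1 + r ^ 2) : ℝ) : ℂ) *
        druryArvesonKernel 2 (annulusToBall r hr0 z) (annulusToBall r hr0 w)) := by
  set t : ℂ := (z : ℂ) * star (w : ℂ) with ht
  have hz1 : r < ‖(z : ℂ)‖ := z.2.1
  have hz2 : ‖(z : ℂ)‖ < 1 := z.2.2
  have hw1 : r < ‖(w : ℂ)‖ := w.2.1
  have hw2 : ‖(w : ℂ)‖ < 1 := w.2.2
  have hz : 0 < ‖(z : ℂ)‖ := hr0.trans hz1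
  have hw : 0 < ‖(w : ℂ)‖ := hr0.trans hw1
  have hnt : ‖t‖ = ‖(z : ℂ)‖ * ‖(w : ℂ)‖ := by rw [ht, norm_mul, norm_star]
  have ht0 : t ≠ 0 := norm_pos_iff.mp (by rw [hnt]; positivity)
  have ht1 : ‖t‖ < 1 := by
    rw [hnt]
    nlinarith
  have hs1 : ‖(r : ℂ) ^ 2 / t‖ < 1 := by
    rw [norm_div, norm_pow, Complex.norm_real, Real.norm_of_nonneg hr0.le,
      div_lt_one (norm_pos_iff.mpr ht0), hnt]
    nlinarith
  have ne1 : ∀ {u : ℂ}, ‖u‖ < 1 → 1 - u ≠ 0 := by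
    intro u hu h0
    rw [← sub_eq_zero.mp h0] at hu
    simp at hu
  have h1 : HasSum (fun k : ℕ => (maxWeight r (k : ℤ) : ℂ) * t ^ (k : ℤ)) (1 - t)⁻¹ := by
    refine (hasSum_geometric_of_norm_lt_one ht1).of_forall_eq fun k => ?_
    rw [maxWeight_natCast hr0 hr1]
    simp
  have h2 : HasSum (fun k : ℕ => (maxWeight r (-((k : ℤ) + 1)) : ℂ) * t ^ (-((k : ℤ) + 1)))
      ((1 - (r : ℂ) ^ 2 / t)⁻¹ * ((r : ℂ) ^ 2 / t)) := by
    refine ((hasSum_geometric_of_norm_lt_one hs1).mul_right _).of_forall_eq fun k => ?_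
    have := maxWeight_neg_natCast hr0 hr1 (k + 1)
    push_cast at this
    rw [this, ← pow_succ, div_pow, zpow_neg]
    have e : t ^ ((k : ℤ) + 1) = t ^ (k + 1) := by exact_mod_cast zpow_natCast t (k + 1)
    rw [e]
    push_cast
    rfl
  have h3 := HasSum.of_nat_of_neg_add_one
    (f := fun n : ℤ => (maxWeight r n : ℂ) * t ^ n) h1 h2
  rw [druryArvesonKernel, inner_annulusToBall, ← ht]
  push_cast
  rw [annulus_kernel_eq ht0 (ne1 ht1) (ne1 hs1) (by
    have : (0 : ℝ) < r ^ 2 + 1 := by positivity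
    exact_mod_cast this.ne')]
  exact h3

/-- Every bounded holomorphic function on the annulus is a multiplier, of norm at most `√2` times
its supremum norm, of the restriction of the Drury-Arveson space. -/
theorem posSemidef_pickKernel {r : ℝ} (hr0 : 0 < r) (hr1 : r < 1) {φ : ℂ → ℂ} {M : ℝ} (hM0 : 0 ≤ M)
    (hφ : DifferentiableOn ℂ φ (annulus r)) (hM : ∀ z ∈ annulus r, ‖φ z‖ ≤ M) :
    (Matrix.of fun z w : annulus r => (((√2 * M : ℝ) : ℂ) ^ 2 - φ z * star (φ w)) *
      druryArvesonKernel 2 (annulusToBall r hr0 z) (annulusToBall r hr0 w)).PosSemidef := by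
  have hmax0 : ∀ n, 0 ≤ maxWeight r n := fun n => by unfold maxWeight; positivity
  have hhar0 : ∀ n, 0 ≤ hardyWeight r n := fun n => by unfold hardyWeight; positivity
  have vec : ∀ d : ℤ → ℝ, (∀ n, 0 ≤ d n) → (∀ n, d n ≤ maxWeight r n) →
      ∃ v : annulus r → lp (fun _ : ℤ => ℂ) 2, ∀ z n, v z n = (√(d n) : ℂ) * (z : ℂ) ^ n :=
    fun d h0 h1 => exists_laurentVec h0 fun z hz => Summable.of_nonneg_of_le
      (fun n => mul_nonneg (h0 n) (by positivity))
      (fun n => mul_le_mul_of_nonneg_right (h1 n) (by positivity)) (summable_maxWeight_mul hr0 hz)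
  have hb0 : ∀ n, 0 ≤ maxWeight r n - hardyWeight r n := fun n =>
    sub_nonneg.mpr (hardyWeight_le_maxWeight hr0 n)
  have hc0 : ∀ n, 0 ≤ 2 * hardyWeight r n - maxWeight r n := fun n =>
    sub_nonneg.mpr (maxWeight_le_two_mul_hardyWeight hr0 n)
  -- With `K` the rescaled kernel and `k` the Hardy kernel, `a`, `b`, `c` are feature maps of `k`,
  -- `K - k` and `2k - K`.
  obtain ⟨a, ha⟩ := vec (hardyWeight r) hhar0 (hardyWeight_le_maxWeight hr0)
  obtain ⟨b, hb⟩ := vec _ hb0 fun n => by linarith [hhar0 n]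
  obtain ⟨c, hc⟩ := vec _ hc0 fun n => by linarith [hardyWeight_le_maxWeight hr0 n]
  set α : ℝ := (1 - r ^ 2) / (1 + r ^ 2) with hα
  have hα0 : 0 < α := div_pos (by nlinarith) (by positivity)
  have e1 : ∀ z w : annulus r, (inner ℂ (b w) (b z) : ℂ) + inner ℂ (a w) (a z) =
      (α : ℂ) * druryArvesonKernel 2 (annulusToBall r hr0 z) (annulusToBall r hr0 w) := by
    intro z w
    refine HasSum.unique (((hasSum_inner_laurentVec hb0 hb z w).add
      (hasSum_inner_laurentVec hhar0 ha z w)).of_forall_eq fun n => ?_)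
      (hasSum_maxWeight hr0 hr1 z w)
    push_cast
    ring
  have e2 : ∀ z w : annulus r, 2 * (inner ℂ (a w) (a z) : ℂ) - inner ℂ (c w) (c z) =
      (α : ℂ) * druryArvesonKernel 2 (annulusToBall r hr0 z) (annulusToBall r hr0 w) := by
    intro z w
    refine HasSum.unique ((((hasSum_inner_laurentVec hhar0 ha z w).mul_left 2).sub
      (hasSum_inner_laurentVec hc0 hc z w)).of_forall_eq fun n => ?_)
      (hasSum_maxWeight hr0 hr1 z w)
    push_cast
    ring
  have p1 := (posSemidef_gram_sub_iff hM0 a fun z => φ z • a z).mpr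
    fun w => norm_sum_smul_laurentVec_le hr0 hr1 hM0 hφ hM ha w
  have p2 := posSemidef_of_inner b
  have p3 := posSemidef_of_inner fun z : annulus r => φ z • c z
  have p := (((p2.smul (by positivity : 0 ≤ M ^ 2 * 2)).add (p1.smul (zero_le_two (α := ℝ)))).add
    p3).smul (inv_nonneg.mpr hα0.le)
  refine p.congr fun z w => ?_
  have hs2 : (((√2 * M : ℝ) : ℂ)) ^ 2 = 2 * M ^ 2 := by
    rw [← Complex.ofReal_pow, mul_pow, Real.sq_sqrt zero_le_two]
    push_cast
    rfl
  have hα' : (α : ℂ) ≠ 0 := by exact_mod_cast hα0.ne'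
  have e3 : druryArvesonKernel 2 (annulusToBall r hr0 z) (annulusToBall r hr0 w) =
      (α : ℂ)⁻¹ * ((inner ℂ (b w) (b z) : ℂ) + inner ℂ (a w) (a z)) := by
    rw [e1]
    field_simp
  have e4 := (e1 z w).trans (e2 z w).symm
  simp only [Matrix.smul_apply, Matrix.add_apply, Matrix.of_apply, inner_smul_left,
    inner_smul_right, hs2, e3, Complex.real_smul, RCLike.star_def]
  push_cast
  linear_combination (α : ℂ)⁻¹ * φ z * (starRingEnd ℂ) (φ w) * e4

/-! ### Sharpness of the constant. -/

theorem sqrt_two_le_of_posSemidef {r : ℝ} (hr0 : 0 < r) (hr1 : r < 1) {N : ℕ} (hN : N ≠ 0)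
    {m : ℝ} (hm : 0 ≤ m)
    (h : (Matrix.of fun z w : annulus r => ((m : ℂ) ^ 2 -
        ((z : ℂ) ^ (N : ℤ) + r ^ N * (z : ℂ) ^ (-(N : ℤ))) *
          star ((w : ℂ) ^ (N : ℤ) + r ^ N * (w : ℂ) ^ (-(N : ℤ)))) *
      druryArvesonKernel 2 (annulusToBall r hr0 z) (annulusToBall r hr0 w)).PosSemidef) :
    √2 ≤ m := by
  set φ : ℂ → ℂ := fun z => z ^ (N : ℤ) + r ^ N * z ^ (-(N : ℤ)) with hφ
  have hmax0 : ∀ n, 0 ≤ maxWeight r n := fun n => by unfold maxWeight; positivity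
  obtain ⟨v, hv⟩ := exists_laurentVec hmax0 fun z hz => summable_maxWeight_mul hr0 hz
  set α : ℝ := (1 - r ^ 2) / (1 + r ^ 2) with hα
  have hα0 : 0 < α := div_pos (by nlinarith) (by positivity)
  have e1 : ∀ z w : annulus r, (inner ℂ (v w) (v z) : ℂ) =
      (α : ℂ) * druryArvesonKernel 2 (annulusToBall r hr0 z) (annulusToBall r hr0 w) := fun z w =>
    (hasSum_inner_laurentVec hmax0 hv z w).unique (hasSum_maxWeight hr0 hr1 z w)
  -- `T` is the transpose of multiplication by `φ`, so its coordinate at `0`, the functional `L`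
  -- below, represents `φ · 1`: `L (v z) = φ z` because the weight at `n = 0` is `1`.
  obtain ⟨T, hT, hTv⟩ := exists_clm_of_norm_sum_le hm ((posSemidef_gram_sub_iff hm v
    fun z => φ z • v z).mp ((h.smul hα0.le).congr fun z w => by
      simp only [Matrix.smul_apply, Matrix.of_apply, inner_smul_left, inner_smul_right, e1,
        Complex.real_smul, RCLike.star_def, hφ]
      ring))
  have hw : ∀ n, √(maxWeight r n) = (max 1 (r ^ n))⁻¹ := fun n => by
    rw [maxWeight, Real.sqrt_inv, Real.sqrt_sq (by positivity)]
  set e : ℤ → lp (fun _ : ℤ => ℂ) 2 := fun n => lp.single 2 n (1 : ℂ) with he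
  have hen : ∀ n, ‖e n‖ = 1 := fun n => by
    rw [he, lp.norm_single (by norm_num)]
    simp
  have hcoord : ∀ x : lp (fun _ : ℤ => ℂ) 2, ‖T x 0‖ ≤ m * ‖x‖ := fun x =>
    (lp.norm_apply_le_norm (by norm_num) (T x) 0).trans ((T.le_opNorm x).trans (by gcongr))
  let L : lp (fun _ : ℤ => ℂ) 2 →L[ℂ] ℂ := LinearMap.mkContinuous
    { toFun := fun x => T x 0
      map_add' := fun x y => by rw [map_add]; rfl
      map_smul' := fun a x => by rw [map_smul]; rfl } m hcoord
  have hLn : ∀ n, ‖L (e n)‖ ≤ m := fun n => by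
    have := hcoord (e n)
    rwa [hen, mul_one] at this
  set a : ℤ → ℂ := fun n => √(maxWeight r n) * L (e n) with haDef
  have hsum : ∀ z : annulus r, HasSum (fun n => a n * (z : ℂ) ^ n) (φ z) := by
    intro z
    have h1 := L.hasSum (lp.hasSum_single (p := 2) (by norm_num) (v z))
    have h2 : L (v z) = φ z := by
      change T (v z) 0 = φ z
      rw [hTv, lp.coeFn_smul, Pi.smul_apply, hv]
      simp [maxWeight]
    rw [h2] at h1
    refine h1.of_forall_eq fun n => ?_
    have : lp.single 2 n (v z n) = (v z n) • e n := by
      rw [he, ← lp.single_smul]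
      simp
    rw [this, map_smul, hv, haDef, smul_eq_mul]
    ring
  have hb : ∀ z : ℂ, HasSum (fun n : ℤ => ((if n = N then 1 else 0) +
      (if n = -(N : ℤ) then (r : ℂ) ^ N else 0)) * z ^ n) (φ z) := by
    intro z
    have h1 := hasSum_single (f := fun n : ℤ => if n = N then z ^ n else 0) (N : ℤ)
      (fun n hn => if_neg hn)
    have h2 := hasSum_single (f := fun n : ℤ => if n = -(N : ℤ) then (r : ℂ) ^ N * z ^ n else 0)
      (-(N : ℤ)) (fun n hn => if_neg hn)
    rw [if_pos rfl] at h1 h2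
    refine (h1.add h2).of_forall_eq fun n => ?_
    split_ifs <;> ring
  obtain ⟨ρ, hρ⟩ := exists_between hr1
  have hρ0 : 0 < ρ := hr0.trans hρ.1
  have hsa : Summable fun n => ‖a n‖ * ρ ^ n := by
    have hz : (ρ : ℂ) ∈ annulus r := by
      simpa [annulus, abs_of_pos hρ0] using hρ
    refine Summable.of_nonneg_of_le (fun n => by positivity) (fun n => ?_)
      ((summable_zpow_div_max hr0 hz).mul_left m)
    rw [haDef]
    simp only [norm_mul, Complex.norm_real, hw]
    rw [Real.norm_of_nonneg (by positivity), Real.norm_of_nonneg hρ0.le]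
    calc _ ≤ (max 1 (r ^ n))⁻¹ * m * ρ ^ n := by
          gcongr
          exact hLn n
      _ = _ := by ring
  have hsb : Summable fun n : ℤ => ‖(if n = N then (1 : ℂ) else 0) +
      (if n = -(N : ℤ) then (r : ℂ) ^ N else 0)‖ * ρ ^ n := by
    refine summable_of_ne_finset_zero (s := {(N : ℤ), -(N : ℤ)}) fun n hn => ?_
    simp only [Finset.mem_insert, Finset.mem_singleton, not_or] at hn
    simp [hn.1, hn.2]
  -- Expanding `L (v z)` in the basis `e n` gives a Laurent series for `φ`, and Laurent coefficients
  -- are unique. In degree `-N` the weight `r ^ N` cancels the coefficient `r ^ N`, so `L` is `1` on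
  -- both `e N` and `e (-N)`.
  have heq : ∀ n : ℤ, a n = (if n = N then 1 else 0) +
      (if n = -(N : ℤ) then (r : ℂ) ^ N else 0) := by
    intro n
    have h1 := fourierCoeff_of_hasSum hρ0.le hsa
      (fun x => hsum ⟨_, circlePoint_mem_annulus hρ hρ0.le x⟩) n
    have h2 := fourierCoeff_of_hasSum hρ0.le hsb (fun x => hb _) n
    exact mul_right_cancel₀ (zpow_ne_zero n (by exact_mod_cast hρ0.ne')) (h1.symm.trans h2)
  have hNN : (N : ℤ) ≠ -(N : ℤ) := by omega
  have hL1 : L (e N) = 1 := by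
    have := heq N
    simp only [haDef, if_true, if_neg hNN, maxWeight_natCast hr0 hr1] at this
    simpa using this
  have hL2 : L (e (-(N : ℤ))) = 1 := by
    have := heq (-(N : ℤ))
    simp only [haDef, if_true, if_neg hNN.symm, maxWeight_neg_natCast hr0 hr1, zero_add] at this
    rw [← pow_mul, mul_comm 2 N, pow_mul, Real.sqrt_sq (by positivity), Complex.ofReal_pow] at this
    have hrN : (r : ℂ) ^ N ≠ 0 := pow_ne_zero _ (by exact_mod_cast hr0.ne')
    exact mul_left_cancel₀ hrN (this.trans (mul_one _).symm)
  have hnorm : ‖e N + e (-(N : ℤ))‖ = √2 := by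
    have h1 := lp.norm_sum_single (p := 2) (by norm_num) (fun _ : ℤ => (1 : ℂ)) {(N : ℤ), -(N : ℤ)}
    rw [Finset.sum_pair hNN, Finset.sum_pair hNN] at h1
    rw [eq_comm, Real.sqrt_eq_iff_mul_self_eq zero_le_two (norm_nonneg _), ← sq]
    norm_num at h1
    exact h1.symm
  have hfin := hcoord (e N + e (-(N : ℤ)))
  have : T (e N + e (-(N : ℤ))) 0 = 2 := by
    change L _ = 2
    rw [map_add, hL1, hL2]
    norm_num
  rw [this, hnorm] at hfin
  have h2 : √2 * √2 ≤ m * √2 := by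
    rw [Real.mul_self_sqrt zero_le_two]
    simpa using hfin
  exact le_of_mul_le_mul_right h2 (by positivity)

/-! ### Existence of the minimum and conclusion. -/

/-- The constants `m ≥ 0` for which the Pick kernel of `φ` is positive semidefinite. -/
def pickConstants (r : ℝ) (hr : 0 < r) (φ : ℂ → ℂ) : Set ℝ :=
  {m | 0 ≤ m ∧ (Matrix.of fun z w : annulus r => ((m : ℂ) ^ 2 - φ z * star (φ w)) *
      druryArvesonKernel 2 (annulusToBall r hr z) (annulusToBall r hr w)).PosSemidef}

/-- Hermitian symmetry holds for every real `m`, and each quadratic form is continuous in `m`. -/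
theorem isClosed_pickConstants (r : ℝ) (hr : 0 < r) (φ : ℂ → ℂ) :
    IsClosed (pickConstants r hr φ) := by
  have e : pickConstants r hr φ = Set.Ici 0 ∩ ⋂ w : annulus r →₀ ℂ, {m : ℝ |
      0 ≤ w.sum fun i xi => w.sum fun j xj => star xi * (((m : ℂ) ^ 2 - φ i * star (φ j)) *
      druryArvesonKernel 2 (annulusToBall r hr i) (annulusToBall r hr j)) * xj} := by
    ext m
    simp only [pickConstants, Set.mem_ofPred_eq, Set.mem_inter_iff, Set.mem_Ici, Set.mem_iInter]
    refine and_congr_right fun _ => ⟨fun h w => h.2 w, fun h => ⟨?_, h⟩⟩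
    ext z w
    have := druryArvesonKernel_conj 2 (annulusToBall r hr w) (annulusToBall r hr z)
    simp only [Matrix.conjTranspose_apply, Matrix.of_apply, star_mul', star_sub, star_pow,
      star_star, this]
    simp
    left
    ring
  rw [e]
  refine isClosed_Ici.inter (isClosed_iInter fun w => isClosed_le continuous_const ?_)
  simp only [Finsupp.sum]
  fun_prop

theorem mem_pickConstants_of_multiplier {r : ℝ} (hr : 0 < r) {φ : ℂ → ℂ} {c : ℝ}
    (hc : c ∈ extensionNorms r hr φ) : c ∈ pickConstants r hr φ := by
  obtain ⟨ψ, ⟨M, hM⟩, hext, rfl⟩ := hc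
  rw [multiplierNorm_eq M hM]
  refine ⟨norm_nonneg _, ?_⟩
  refine ((posSemidef_of_multiplier M hM le_rfl).submatrix (annulusToBall r hr)).congr
    fun z w => ?_
  simp [hext]

/-- The Pick property gives an extension of norm at most `m`. Its norm is itself a Pick constant,
hence exactly `m`. -/
theorem isLeast_extensionNorms {r : ℝ} (hr : 0 < r) {φ : ℂ → ℂ} {m : ℝ}
    (hm : IsLeast (pickConstants r hr φ) m) : IsLeast (extensionNorms r hr φ) m := by
  obtain ⟨⟨hm0, hpos⟩, hlb⟩ := hm
  refine ⟨?_, fun c hc => hlb (mem_pickConstants_of_multiplier hr hc)⟩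
  obtain ⟨ψ, hψ, hψpos⟩ := exists_extension_of_posSemidef (annulusToBall r hr)
    (fun z => φ z) hpos
  obtain ⟨M, hMn, hM⟩ := exists_multiplier_of_posSemidef hm0 hψpos
  have hmem : ‖M‖ ∈ extensionNorms r hr φ := ⟨ψ, ⟨M, hM⟩, hψ, multiplierNorm_eq M hM⟩
  rwa [le_antisymm (hlb (mem_pickConstants_of_multiplier hr hmem)) hMn]

theorem norm_le_of_mem_pickConstants {r : ℝ} (hr : 0 < r) {φ : ℂ → ℂ} {m : ℝ}
    (hm : m ∈ pickConstants r hr φ) (z : annulus r) : ‖φ z‖ ≤ m := by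
  have h := hm.2.diag_nonneg (i := z)
  have hk : druryArvesonKernel 2 (annulusToBall r hr z) (annulusToBall r hr z) =
      (((1 - ‖(annulusToBall r hr z : EuclideanSpace ℂ (Fin 2))‖ ^ 2)⁻¹ : ℝ) : ℂ) := by
    rw [druryArvesonKernel, inner_self_eq_norm_sq_to_K]
    simp
  have hpos : 0 < (1 - ‖(annulusToBall r hr z : EuclideanSpace ℂ (Fin 2))‖ ^ 2)⁻¹ := by
    have := mem_ball_zero_iff.mp (annulusToBall r hr z).2
    refine inv_pos.mpr (sub_pos.mpr ?_)
    exact pow_lt_one₀ (norm_nonneg _) this two_ne_zero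
  rw [Matrix.of_apply, hk, RCLike.star_def, Complex.mul_conj'] at h
  have h2 : 0 ≤ (m ^ 2 - ‖φ z‖ ^ 2) *
      (1 - ‖(annulusToBall r hr z : EuclideanSpace ℂ (Fin 2))‖ ^ 2)⁻¹ := by exact_mod_cast h
  have h3 := nonneg_of_mul_nonneg_left h2 hpos
  exact (sq_le_sq₀ (norm_nonneg _) hm.1).mp (sub_nonneg.mp h3)

theorem norm_le_supNorm {r : ℝ} {φ : ℂ → ℂ} (hφ : IsHInf r φ) {z : ℂ} (hz : z ∈ annulus r) :
    ‖φ z‖ ≤ supNorm r φ := by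
  obtain ⟨C, hC⟩ := hφ.2
  exact le_ciSup (f := fun z : annulus r => ‖φ z‖) ⟨C, by rintro _ ⟨w, rfl⟩; exact hC w w.2⟩ ⟨z, hz⟩

theorem nonempty_annulus {r : ℝ} (hr0 : 0 < r) (hr1 : r < 1) : Nonempty (annulus r) := by
  obtain ⟨ρ, hρ⟩ := exists_between hr1
  exact ⟨⟨ρ, by simpa [annulus, abs_of_pos (hr0.trans hρ.1)] using hρ⟩⟩

theorem exists_isLeast_pickConstants {r : ℝ} (hr0 : 0 < r) (hr1 : r < 1) {φ : ℂ → ℂ}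
    (hφ : IsHInf r φ) : ∃ m, IsLeast (pickConstants r hr0 φ) m ∧
      m ∈ Set.Icc (supNorm r φ) (√2 * supNorm r φ) := by
  have := nonempty_annulus hr0 hr1
  have h0 : 0 ≤ supNorm r φ := Real.iSup_nonneg fun _ => norm_nonneg _
  have hmem : √2 * supNorm r φ ∈ pickConstants r hr0 φ :=
    ⟨by positivity, posSemidef_pickKernel hr0 hr1 h0 hφ.1 fun z hz => norm_le_supNorm hφ hz⟩
  have hbdd : BddBelow (pickConstants r hr0 φ) := ⟨0, fun m hm => hm.1⟩
  have hm := (isClosed_pickConstants r hr0 φ).csInf_mem ⟨_, hmem⟩ hbdd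
  exact ⟨_, ⟨hm, fun c hc => csInf_le hbdd hc⟩,
    ciSup_le fun z => norm_le_of_mem_pickConstants hr0 hm z, csInf_le hbdd hmem⟩

/-- With `x = ‖z‖ ^ N` in `[r ^ N, 1]`, this is `(1 - x)(x - r ^ N) ≥ 0` after division by `x`. -/
theorem norm_zpow_add_zpow_neg_le {r : ℝ} (hr0 : 0 < r) (N : ℕ) {z : ℂ} (hz : z ∈ annulus r) :
    ‖z ^ (N : ℤ) + r ^ N * z ^ (-(N : ℤ))‖ ≤ 1 + r ^ N := by
  have hz0 := hr0.trans hz.1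
  refine (norm_add_le _ _).trans ?_
  rw [norm_mul, norm_zpow, norm_zpow, norm_pow, Complex.norm_real, Real.norm_of_nonneg hr0.le,
    zpow_neg, zpow_natCast]
  have h1 : r ^ N ≤ ‖z‖ ^ N := pow_le_pow_left₀ hr0.le hz.1.le N
  have h2 : ‖z‖ ^ N ≤ 1 := pow_le_one₀ hz0.le hz.2.le
  have h3 : 0 < ‖z‖ ^ N := by positivity
  rw [← div_eq_mul_inv, ← le_sub_iff_add_le', div_le_iff₀ h3]
  nlinarith

theorem isHInf_zpow_add_zpow_neg {r : ℝ} (hr0 : 0 < r) (N : ℕ) :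
    IsHInf r fun z => z ^ (N : ℤ) + r ^ N * z ^ (-(N : ℤ)) := by
  refine ⟨fun z hz => ?_, 1 + r ^ N, fun z hz => norm_zpow_add_zpow_neg_le hr0 N hz⟩
  have hz0 : z ≠ 0 := norm_pos_iff.mp (hr0.trans hz.1)
  exact ((differentiableAt_zpow.mpr (Or.inl hz0)).add
    ((differentiableAt_zpow.mpr (Or.inl hz0)).const_mul _)).differentiableWithinAt

theorem theorem2 (r : ℝ) (hr0 : 0 < r) (hr1 : r < 1) :
    (∀ φ : ℂ → ℂ, IsHInf r φ →
      ∃ m : ℝ, IsLeast (extensionNorms r hr0 φ) m ∧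
        m ∈ Set.Icc (supNorm r φ) (√2 * supNorm r φ)) ∧
    (∀ C : ℝ,
      (∀ φ : ℂ → ℂ, IsHInf r φ →
        ∀ m : ℝ, IsLeast (extensionNorms r hr0 φ) m → m ≤ C * supNorm r φ) →
      √2 ≤ C) := by
  refine ⟨fun φ hφ => ?_, fun C hC => ?_⟩
  · obtain ⟨m, hm, hmI⟩ := exists_isLeast_pickConstants hr0 hr1 hφ
    exact ⟨m, isLeast_extensionNorms hr0 hm, hmI⟩
  · have := nonempty_annulus hr0 hr1
    -- The exponent is shifted to `N + 1` because for exponent `0` the two monomials coincide.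
    have key : ∀ N : ℕ, √2 ≤ C * (1 + r ^ (N + 1)) := by
      intro N
      have hφ := isHInf_zpow_add_zpow_neg hr0 (N + 1)
      obtain ⟨m, hm, hmI⟩ := exists_isLeast_pickConstants hr0 hr1 hφ
      have h1 : √2 ≤ m := sqrt_two_le_of_posSemidef hr0 hr1 N.succ_ne_zero hm.1.1 hm.1.2
      have h2 := h1.trans (hC _ hφ m (isLeast_extensionNorms hr0 hm))
      have h3 : supNorm r (fun z => z ^ ((N + 1 : ℕ) : ℤ) + r ^ (N + 1) * z ^ (-((N + 1 : ℕ) : ℤ)))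
          ≤ 1 + r ^ (N + 1) := ciSup_le fun z => norm_zpow_add_zpow_neg_le hr0 (N + 1) z.2
      have h0 : 0 ≤ supNorm r (fun z => z ^ ((N + 1 : ℕ) : ℤ) +
          r ^ (N + 1) * z ^ (-((N + 1 : ℕ) : ℤ))) := Real.iSup_nonneg fun _ => norm_nonneg _
      have hC0 : 0 ≤ C := by
        by_contra hneg
        have : 0 < √2 := by positivity
        nlinarith
      exact h2.trans (mul_le_mul_of_nonneg_left h3 hC0)
    have hlim : Filter.Tendsto (fun N : ℕ => C * (1 + r ^ (N + 1))) Filter.atTop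
        (nhds (C * (1 + 0))) :=
      ((((tendsto_pow_atTop_nhds_zero_of_lt_one hr0.le hr1).comp
        (Filter.tendsto_add_atTop_nat 1)).const_add 1).const_mul C)
    simpa using ge_of_tendsto' hlim key

end
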